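/- Let $(\Omega,\mathcal F,\mathbb P)$ be a probability space and let $\{X_t\}_{t\ge 0}$ be a real-valued self-similar Lévy process on it of stability index $\alpha$, where $0<\alpha<2$. That is, $X_0=0$, the process has stationary and independent increments, $X_{at}$ and $a^{1/\alpha}X_t$ have the same distribution for all $a>0$ and $t>0$, and the process is non-degenerate: $X_1$ is not almost surely constant. (Equivalently, $X_t$ has a strictly stable law of index $\alpha$ with positive scale parameter.) For a real number $q\ge 0$ and positive integers $\tau,N$ with $\tau\mid N$, define the empirical moment $${}^q\!M^\tau_N:=\frac{1}{N/\tau}\sum_{n=1}^{N/\tau}\bigl|X_{n\tau}-X_{(n-1)\tau}\bigr|^q .$$ Let $\mathcal T$ be a positive integer, and for $k\ge 1$ set $N_k:=k\,\mathrm{lcm}(1,2,\dots,\mathcal T)$. Put $\nu_e(q):=q/\alpha$ if $q<\alpha$ and $\nu_e(q):=1$ if $q\ge\alpha$. Then, for every $q\ge 0$, $$\mathbb P\Biggl[\,\bigcap_{\tau=1}^{\mathcal T}\biggl\{\omega\in\Omega:\ \lim_{k\to\infty}\frac{{}^q\!M^\tau_{N_k}(\omega)}{{}^q\!M^1_{N_k}(\omega)}=\tau^{\nu_e(q)}\biggr\}\Biggr]=1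 .$$ -/

import Mathlib

open MeasureTheory ProbabilityTheory Filter Topology
open scoped NNReal

/-- A real-valued Lévy process on the time axis `[0, ∞)`: it starts at `0` and has stationary and
independent increments. -/
structure IsLevyProcess {Ω : Type*} [MeasurableSpace Ω] (X : ℝ≥0 → Ω → ℝ) (P : Measure Ω) :
    Prop where
  measurable : ∀ t, Measurable (X t)
  start_zero : ∀ᵐ ω ∂P, X 0 ω = 0
  stationary : ∀ t s : ℝ≥0,
    IdentDistrib (fun ω => X (t + s) ω - X t ω) (fun ω => X s ω - X 0 ω) P P
  indep : HasIndepIncrements X P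

/-- Self-similarity with scaling exponent `H`: `X (a t)` and `a ^ H * X t` have the same law for
all `a, t > 0`. -/
def IsSelfSimilarWith {Ω : Type*} [MeasurableSpace Ω] (H : ℝ) (X : ℝ≥0 → Ω → ℝ)
    (P : Measure Ω) : Prop :=
  ∀ a t : ℝ≥0, 0 < a → 0 < t →
    IdentDistrib (X (a * t)) (fun ω => (a : ℝ) ^ H * X t ω) P P

/-- A self-similar (that is, strictly stable) Lévy process of stability index `α`: a Lévy process
that is self-similar with scaling exponent `1 / α` and whose law at time `1` is not a point mass.
Non-degeneracy is the condition that the scale parameter of the strictly stable law is positive;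
it excludes the zero process and, for `α = 1`, the deterministic drifts `X t = c * t`. -/
structure IsSelfSimilarLevyProcess {Ω : Type*} [MeasurableSpace Ω] (α : ℝ) (X : ℝ≥0 → Ω → ℝ)
    (P : Measure Ω) : Prop extends IsLevyProcess X P where
  selfSimilar : IsSelfSimilarWith (1 / α) X P
  nondegenerate : ∀ c : ℝ, ¬ ∀ᵐ ω ∂P, X 1 ω = c

/-- The empirical moment of order `q` at scale `τ` from `N` unit time steps (`τ ∣ N`): the average
of `|X ((n + 1) τ) - X (n τ)| ^ q` over the `N / τ` consecutive windows of size `τ`. -/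
noncomputable def empiricalMoment {Ω : Type*} (X : ℝ≥0 → Ω → ℝ) (q : ℝ) (τ N : ℕ) (ω : Ω) : ℝ :=
  (1 / ((N / τ : ℕ) : ℝ)) *
    ∑ n ∈ Finset.range (N / τ),
      |X (((n + 1) * τ : ℕ) : ℝ≥0) ω - X ((n * τ : ℕ) : ℝ≥0) ω| ^ q

/-- The empirical scaling function: `q / α` for `q < α` and `1` for `q ≥ α`. -/
noncomputable def empiricalScaling (α q : ℝ) : ℝ :=
  if q < α then q / α else 1

/-- The least common multiple of the integers `1, …, T`. -/
def lcmUpTo (T : ℕ) : ℕ := (Finset.Icc 1 T).lcm id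

/-! For `q < α` both empirical moments obey the strong law, and self-similarity makes the ratio of
the means `τ ^ (q / α)`.

For `q ≥ α` the mean is infinite and the largest increments dominate. Inside a window of length `τ`,
`|∑ x i| ^ q` and `∑ |x i| ^ q` differ by a small multiple of the latter plus products `(|x a| * |x
b|) ^ (q / 2)` with `a ≠ b` (`exists_abs_sum_rpow_sub_le`). By independence such a product has a
finite moment of order `r` as soon as `q * r / 2 < α`, so `m` of them sum to `O(m ^ (1 / r))`
(`ae_exists_sum_cross_le`). The sum of `q`-th powers of unit increments grows faster for a suitable
`r` (`exists_growth`). Hence the two sums are asymptotically equal, and the ratio `τ` of the numbers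
of windows is the limit.

The tail estimates need no characteristic functions. They come from one identity: the law `μ` of `X
1` satisfies `μ ∗ μ =` dilation of `μ` by `2 ^ (1 / α)`. Comparing tails at `x` and at about `2 ^ (1
/ α) * x` gives upper bounds `x ^ (-a)` for `a < α`, and lower bounds `x ^ (-b)` for `α < b < 2 *
α`. The lower bound needs a starting point, supplied by `lintegral_abs_rpow_eq_top`: equality in
Clarkson's inequality would make a law with finite `α`-moment degenerate. -/

/-- The two-sided tail `x ↦ μ {y | x < |y|}` of a measure on the line. -/
noncomputable def absTail (μ : Measure ℝ) (x : ℝ) : ℝ := μ.real {y | x < |y|}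

lemma measurableSet_lt_abs (x : ℝ) : MeasurableSet {y : ℝ | x < |y|} :=
  measurableSet_lt measurable_const continuous_abs.measurable

lemma absTail_nonneg (μ : Measure ℝ) (x : ℝ) : 0 ≤ absTail μ x := measureReal_nonneg

lemma absTail_le_one (μ : Measure ℝ) [IsProbabilityMeasure μ] (x : ℝ) : absTail μ x ≤ 1 :=
  measureReal_le_one

lemma absTail_antitone (μ : Measure ℝ) [IsProbabilityMeasure μ] : Antitone (absTail μ) := by
  intro x y h
  exact measureReal_mono (fun z (hz : y < |z|) => lt_of_le_of_lt h hz)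

lemma tendsto_absTail_atTop (μ : Measure ℝ) [IsProbabilityMeasure μ] :
    Tendsto (absTail μ) atTop (𝓝 0) := by
  have h : Tendsto (fun x : ℝ => μ {y : ℝ | x < |y|}) atTop (𝓝 (μ (⋂ x : ℝ, {y : ℝ | x < |y|}))) :=
    tendsto_measure_iInter_atTop (fun x => (measurableSet_lt_abs x).nullMeasurableSet)
      (fun x y h z (hz : y < |z|) => lt_of_le_of_lt h hz) ⟨0, measure_ne_top _ _⟩
  have h0 : (⋂ x : ℝ, {y : ℝ | x < |y|}) = ∅ := by
    ext y
    simp only [Set.mem_iInter, Set.mem_ofPred_eq, Set.mem_empty_iff_false, iff_false, not_forall]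
    exact ⟨|y|, lt_irrefl _⟩
  rw [h0, measure_empty] at h
  exact (ENNReal.tendsto_toReal ENNReal.zero_ne_top).comp h

/-! ### Tail inequalities from the convolution identity -/

section Conv

variable {μ : Measure ℝ} [IsProbabilityMeasure μ] {c : ℝ}

omit [IsProbabilityMeasure μ] in
lemma absTail_eq_prod (hc : 0 < c) (hμ : μ.conv μ = μ.map (fun x => c * x)) (x : ℝ) :
    absTail μ x = (μ.prod μ).real {p : ℝ × ℝ | c * x < |p.1 + p.2|} := by
  have h1 : (μ.map (fun x => c * x)).real {y | c * x < |y|} = absTail μ x := by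
    rw [map_measureReal_apply (by fun_prop) (measurableSet_lt_abs _), absTail]
    congr 1
    ext y
    simp [abs_mul, abs_of_pos hc, hc]
  rw [← h1, ← hμ, Measure.conv, map_measureReal_apply (by fun_prop) (measurableSet_lt_abs _)]
  rfl

/-- If one summand exceeds `c * x + m` in size and the other is at most `m`, the sum exceeds `c *
x`. The two choices of the large summand are disjoint events. -/
lemma two_mul_absTail_le (hc : 0 < c) (hμ : μ.conv μ = μ.map (fun x => c * x)) {x m : ℝ}
    (hx : 0 ≤ x) :
    2 * (absTail μ (c * x + m) * (1 - absTail μ m)) ≤ absTail μ x := by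
  set A : Set ℝ := {y | c * x + m < |y|}
  set B : Set ℝ := {y | m < |y|}
  have hA : MeasurableSet A := measurableSet_lt_abs _
  have hB : MeasurableSet B := measurableSet_lt_abs _
  have hBc : μ.real Bᶜ = 1 - absTail μ m := by rw [probReal_compl_eq_one_sub hB]; rfl
  have hd : Disjoint (A ×ˢ Bᶜ) (Bᶜ ×ˢ A) := by
    rw [Set.disjoint_left]
    rintro ⟨u, v⟩ ⟨h1, _⟩ ⟨h2, _⟩
    simp only [A, B, Set.mem_ofPred_eq, Set.mem_compl_iff, not_lt] at h1 h2
    nlinarith [mul_nonneg hc.le hx]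
  have hu : (μ.prod μ).real (A ×ˢ Bᶜ ∪ Bᶜ ×ˢ A) =
      2 * (absTail μ (c * x + m) * (1 - absTail μ m)) := by
    rw [measureReal_union hd (hB.compl.prod hA), measureReal_prod_prod, measureReal_prod_prod, hBc]
    simp only [absTail, A]
    ring
  rw [← hu, absTail_eq_prod hc hμ]
  refine measureReal_mono ?_
  rintro ⟨u, v⟩ (⟨h1, h2⟩ | ⟨h1, h2⟩) <;>
  · simp only [A, B, Set.mem_ofPred_eq, Set.mem_compl_iff, not_lt] at h1 h2 ⊢
    have e1 := abs_sub_abs_le_abs_sub u (-v)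
    have e2 := abs_sub_abs_le_abs_sub v (-u)
    rw [abs_neg, sub_neg_eq_add] at e1 e2
    rw [add_comm v u] at e2
    linarith

/-- For the sum to exceed `c * x`, either one summand exceeds `(1 - ε) * c * x`, or both exceed `ε *
c * x`. Independence turns the second case into a square. -/
lemma absTail_le_two_mul_add_sq (hc : 0 < c) (hμ : μ.conv μ = μ.map (fun x => c * x))
    (x ε : ℝ) :
    absTail μ x ≤ 2 * absTail μ ((1 - ε) * c * x) + absTail μ (ε * c * x) ^ 2 := by
  set A : Set ℝ := {y | (1 - ε) * c * x < |y|}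
  set B : Set ℝ := {y | ε * c * x < |y|}
  rw [absTail_eq_prod hc hμ]
  have h : {p : ℝ × ℝ | c * x < |p.1 + p.2|} ⊆ (A ×ˢ Set.univ ∪ Set.univ ×ˢ A) ∪ B ×ˢ B := by
    rintro ⟨u, v⟩ h
    simp only [A, B, Set.mem_union, Set.mem_prod, Set.mem_ofPred_eq, Set.mem_univ, and_true,
      true_and] at h ⊢
    by_contra! hcon
    obtain ⟨⟨h1, h2⟩, h3⟩ := hcon
    have h4 := abs_add_le u v
    have h5 : ε * c * x < |u| := by linarith
    have h6 := h3 h5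
    linarith
  refine (measureReal_mono h).trans ((measureReal_union_le _ _).trans ?_)
  refine (add_le_add_left (measureReal_union_le _ _) _).trans (le_of_eq ?_)
  simp only [measureReal_prod_prod, probReal_univ, absTail, A, B]
  ring

end Conv

/-- A function that does not increase under dilation by `lam > 1` is bounded by its bound on a
fundamental interval. -/
lemma le_of_dilation_le {g : ℝ → ℝ} {lam x₀ B : ℝ} (hlam : 1 < lam) (hx₀ : 0 < x₀)
    (hB : ∀ x, x₀ ≤ x → x ≤ lam * x₀ → g x ≤ B)
    (hg : ∀ x, x₀ ≤ x → g x ≤ B → g (lam * x) ≤ B) {x : ℝ} (hx : x₀ ≤ x) : g x ≤ B := by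
  have key : ∀ n : ℕ, ∀ x, x₀ ≤ x → x ≤ lam ^ (n + 1) * x₀ → g x ≤ B := by
    intro n
    induction n with
    | zero => intro x h1 h2; exact hB x h1 (by simpa using h2)
    | succ n ih =>
      intro x h1 h2
      by_cases h3 : x ≤ lam * x₀
      · exact hB x h1 h3
      · have hl : 0 < lam := by linarith
        have e : x = lam * (x / lam) := by field_simp
        rw [e]
        have h4 : x₀ ≤ x / lam := by rw [le_div_iff₀ hl]; linarith
        refine hg _ h4 (ih _ h4 ?_)
        rw [div_le_iff₀ hl]
        calc x ≤ _ := h2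
          _ = _ := by ring
  obtain ⟨n, hn⟩ := pow_unbounded_of_one_lt (x / x₀) hlam
  refine key n x hx ?_
  rw [div_lt_iff₀ hx₀] at hn
  refine hn.le.trans ?_
  have : lam ^ n ≤ lam ^ (n + 1) := pow_le_pow_right₀ hlam.le (by omega)
  nlinarith

/-- At `ε = 0` the expression is `c ^ a / 2 < 1`; continuity leaves room for a slightly larger
dilation and a slightly weaker decay of the tail. -/
lemma exists_upper_dilation {c a : ℝ} (hc : 0 < c) (hca : c ^ a < 2) :
    ∃ ε : ℝ, 0 < ε ∧ (1 + ε) / 2 * ((1 + ε) * c) ^ a ≤ 1 := by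
  have h : Tendsto (fun ε : ℝ => (1 + ε) / 2 * ((1 + ε) * c) ^ a) (𝓝[>] 0)
      (𝓝 ((1 + 0) / 2 * ((1 + 0) * c) ^ a)) := by
    refine Tendsto.mono_left ?_ nhdsWithin_le_nhds
    refine ContinuousAt.tendsto (f := fun ε : ℝ => (1 + ε) / 2 * ((1 + ε) * c) ^ a) ?_
    refine ContinuousAt.mul (by fun_prop) (ContinuousAt.rpow_const (by fun_prop) (Or.inl ?_))
    simpa using hc.ne'
  have h2 : (1 + 0) / 2 * ((1 + 0) * c) ^ a < 1 := by rw [add_zero, one_mul]; linarith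
  obtain ⟨ε, h3, h4⟩ := ((h.eventually_lt_const h2).and self_mem_nhdsWithin).exists
  exact ⟨ε, h4, h3.le⟩

lemma exists_lower_dilation {c b : ℝ} (hc : 1 < c) (hcb : 2 < c ^ b) :
    ∃ ε : ℝ, 0 < ε ∧ 1 < (1 - ε) * c ∧ 1 ≤ (1 - ε) / 2 * ((1 - ε) * c) ^ b := by
  have h : Tendsto (fun ε : ℝ => (1 - ε) / 2 * ((1 - ε) * c) ^ b) (𝓝[>] 0)
      (𝓝 ((1 - 0) / 2 * ((1 - 0) * c) ^ b)) := by
    refine Tendsto.mono_left ?_ nhdsWithin_le_nhds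
    refine ContinuousAt.tendsto (f := fun ε : ℝ => (1 - ε) / 2 * ((1 - ε) * c) ^ b) ?_
    refine ContinuousAt.mul (by fun_prop) (ContinuousAt.rpow_const (by fun_prop) (Or.inl ?_))
    simpa using (by linarith : c ≠ 0)
  have h' : Tendsto (fun ε : ℝ => (1 - ε) * c) (𝓝[>] 0) (𝓝 ((1 - 0) * c)) := by
    refine Tendsto.mono_left ?_ nhdsWithin_le_nhds
    exact ContinuousAt.tendsto (f := fun ε : ℝ => (1 - ε) * c) (by fun_prop)
  have h2 : 1 < (1 - 0) / 2 * ((1 - 0) * c) ^ b := by rw [sub_zero, one_mul]; linarith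
  obtain ⟨ε, ⟨h3, h5⟩, h4⟩ := (((h.eventually_const_lt h2).and
    (h'.eventually_const_lt (by simpa using hc : 1 < (1 - 0) * c))).and self_mem_nhdsWithin).exists
  exact ⟨ε, h4, h5, h3.le⟩

/-! ### Polynomial tail bounds and moments -/

section Tail

variable {μ : Measure ℝ} [IsProbabilityMeasure μ] {c : ℝ}

/-- With `m = ε * c * x` in `two_mul_absTail_le`, dilation by `lam` costs the tail a factor `(1 + ε)
/ 2` at large `x`, so `x ^ a * absTail μ x` does not increase. -/
lemma exists_absTail_le_rpow (hc : 1 < c) (hμ : μ.conv μ = μ.map (fun x => c * x)) {a : ℝ}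
    (ha : 0 ≤ a) (hca : c ^ a < 2) :
    ∃ C : ℝ, 0 < C ∧ ∀ x, 0 < x → absTail μ x ≤ C * x ^ (-a) := by
  have hc0 : 0 < c := by linarith
  obtain ⟨ε, hε, hle⟩ := exists_upper_dilation hc0 hca
  set lam := (1 + ε) * c with hlam
  have hlam1 : 1 < lam := by nlinarith
  have hlam0 : 0 < lam := by linarith
  -- This threshold makes `1 - absTail μ m` at least `1 / (1 + ε)`.
  have hev : ∀ᶠ x in atTop, absTail μ x < ε / (1 + ε) :=
    (tendsto_absTail_atTop μ).eventually_lt_const (by positivity)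
  obtain ⟨x₁, hx₁⟩ := eventually_atTop.1 hev
  set x₀ := max 1 (x₁ / (ε * c)) with hx₀def
  have hx₀ : 0 < x₀ := lt_of_lt_of_le one_pos (le_max_left _ _)
  have hstep : ∀ x, x₀ ≤ x → absTail μ (lam * x) ≤ (1 + ε) / 2 * absTail μ x := by
    intro x hx
    have hx0 : 0 < x := by linarith
    have h1 := two_mul_absTail_le hc0 hμ (m := ε * c * x) hx0.le
    have h2 : absTail μ (ε * c * x) < ε / (1 + ε) := by
      apply hx₁
      have : x₁ / (ε * c) ≤ x := (le_max_right _ _).trans hx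
      rw [div_le_iff₀ (by positivity)] at this
      linarith
    have h3 : c * x + ε * c * x = lam * x := by rw [hlam]; ring
    rw [h3] at h1
    have h4 : 1 / (1 + ε) ≤ 1 - absTail μ (ε * c * x) := by
      have : 1 / (1 + ε) = 1 - ε / (1 + ε) := by field_simp; ring
      linarith
    have h5 := mul_le_mul_of_nonneg_left h4 (absTail_nonneg μ (lam * x))
    have h6 : absTail μ (lam * x) = (1 + ε) * (absTail μ (lam * x) * (1 / (1 + ε))) := by
      field_simp
    rw [h6]
    nlinarith
  set B := (lam * x₀) ^ a with hB
  have hB0 : 0 < B := by positivity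
  have key : ∀ x, x₀ ≤ x → x ^ a * absTail μ x ≤ B := by
    intro x hx
    refine le_of_dilation_le (g := fun x => x ^ a * absTail μ x) hlam1 hx₀ ?_ ?_ hx
    · intro x h1 h2
      calc x ^ a * absTail μ x ≤ x ^ a * 1 :=
            mul_le_mul_of_nonneg_left (absTail_le_one _ _) (Real.rpow_nonneg (by linarith) _)
        _ ≤ B := by rw [mul_one]; exact Real.rpow_le_rpow (by linarith) h2 ha
    · intro x h1 h2
      have hx0 : 0 < x := by linarith
      refine le_trans ?_ h2
      rw [Real.mul_rpow hlam0.le hx0.le]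
      calc lam ^ a * x ^ a * absTail μ (lam * x)
          ≤ lam ^ a * x ^ a * ((1 + ε) / 2 * absTail μ x) :=
            mul_le_mul_of_nonneg_left (hstep x h1) (by positivity)
        _ = ((1 + ε) / 2 * lam ^ a) * (x ^ a * absTail μ x) := by ring
        _ ≤ 1 * (x ^ a * absTail μ x) := mul_le_mul_of_nonneg_right hle
            (mul_nonneg (by positivity) (absTail_nonneg _ _))
        _ = _ := one_mul _
  refine ⟨max B (x₀ ^ a), by positivity, fun x hx => ?_⟩
  rw [Real.rpow_neg hx.le, ← div_eq_mul_inv, le_div_iff₀ (by positivity), mul_comm]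
  rcases le_total x₀ x with h | h
  · exact (key x h).trans (le_max_left _ _)
  · refine le_trans ?_ (le_max_right _ _)
    calc x ^ a * absTail μ x ≤ x ^ a * 1 :=
          mul_le_mul_of_nonneg_left (absTail_le_one _ _) (by positivity)
      _ ≤ _ := by rw [mul_one]; exact Real.rpow_le_rpow hx.le h ha

/-- The squared term in `absTail_le_two_mul_add_sq` is `O(x ^ (-(2 * a)))` by the upper bound. Once
`x ^ (2 * a) * absTail μ x` passes a threshold, that term is absorbed and the lower bound propagates
under dilation by `lam`. -/
lemma exists_rpow_le_absTail (hc : 1 < c) (hμ : μ.conv μ = μ.map (fun x => c * x)) {a : ℝ}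
    (ha : 0 ≤ a) (hca : c ^ a < 2) (hca2 : 2 < c ^ (2 * a))
    (hlarge : ∀ K : ℝ, ∃ y, 0 < y ∧ K ≤ y ^ (2 * a) * absTail μ y) :
    ∃ K : ℝ, 0 < K ∧ ∃ x₀ : ℝ, 0 < x₀ ∧ ∀ x, x₀ ≤ x → K * x ^ (-(2 * a)) ≤ absTail μ x := by
  have hc0 : 0 < c := by linarith
  obtain ⟨C, hC, hCle⟩ := exists_absTail_le_rpow hc hμ ha hca
  obtain ⟨ε, hε, hlam1, hle⟩ := exists_lower_dilation hc hca2
  set lam := (1 - ε) * c with hlam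
  have hlam0 : 0 < lam := by linarith
  set η := ε * c with hη
  have hη0 : 0 < η := by positivity
  -- The threshold at which `absTail μ (η * x) ^ 2 ≤ ε * absTail μ x`.
  set K := (C * η ^ (-a)) ^ 2 / ε with hK
  have hK0 : 0 < K := by positivity
  -- The factor `lam ^ (2 * a)` pays for extending the bound at `y` to all of `[y / lam, y]` by
  -- monotonicity of the tail.
  obtain ⟨y, hy0, hy⟩ := hlarge (K * lam ^ (2 * a))
  have hstep : ∀ x, 0 < x → K ≤ x ^ (2 * a) * absTail μ x →
      K ≤ (lam * x) ^ (2 * a) * absTail μ (lam * x) := by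
    intro x hx h
    have h1 := absTail_le_two_mul_add_sq hc0 hμ x ε
    have hp : x ^ (2 * a) = (x ^ a) ^ 2 := by
      rw [mul_comm, Real.rpow_mul hx.le]; norm_num
    have h2 : absTail μ (η * x) ^ 2 ≤ ε * absTail μ x := by
      have h3 := hCle (η * x) (by positivity)
      have h4 : absTail μ (η * x) ^ 2 ≤ (C * (η * x) ^ (-a)) ^ 2 :=
        pow_le_pow_left₀ (absTail_nonneg _ _) h3 2
      refine h4.trans ?_
      rw [Real.mul_rpow hη0.le hx.le, ← mul_assoc, mul_pow, Real.rpow_neg hx.le, inv_pow, ← hp,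
        ← div_eq_mul_inv, div_le_iff₀ (by positivity)]
      rw [hK, div_le_iff₀ hε] at h
      linarith
    have h5 : (1 - ε) / 2 * absTail μ x ≤ absTail μ (lam * x) := by
      linarith
    refine h.trans ?_
    rw [Real.mul_rpow hlam0.le hx.le]
    calc x ^ (2 * a) * absTail μ x = 1 * (x ^ (2 * a) * absTail μ x) := (one_mul _).symm
      _ ≤ ((1 - ε) / 2 * lam ^ (2 * a)) * (x ^ (2 * a) * absTail μ x) :=
          mul_le_mul_of_nonneg_right hle (mul_nonneg (by positivity) (absTail_nonneg _ _))
      _ = lam ^ (2 * a) * x ^ (2 * a) * ((1 - ε) / 2 * absTail μ x) := by ring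
      _ ≤ _ := mul_le_mul_of_nonneg_left h5 (by positivity)
  refine ⟨K, hK0, y / lam, by positivity, fun x hx => ?_⟩
  have hx0 : 0 < x := lt_of_lt_of_le (by positivity) hx
  rw [Real.rpow_neg hx0.le, ← div_eq_mul_inv, div_le_iff₀ (by positivity), mul_comm (absTail μ x)]
  have := le_of_dilation_le (g := fun x => -(x ^ (2 * a) * absTail μ x)) (B := -K) hlam1
    (by positivity : 0 < y / lam) ?_ ?_ hx
  · simpa using this
  · intro z h1 h2
    have h3 : z ≤ y := by rwa [mul_div_cancel₀ _ hlam0.ne'] at h2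
    have hz : 0 < z := lt_of_lt_of_le (by positivity) h1
    rw [neg_le_neg_iff]
    have h4 : absTail μ y ≤ absTail μ z := absTail_antitone μ h3
    have h5 : y ^ (2 * a) ≤ lam ^ (2 * a) * z ^ (2 * a) := by
      rw [← Real.mul_rpow hlam0.le hz.le]
      refine Real.rpow_le_rpow hy0.le ?_ (by linarith)
      rw [div_le_iff₀ hlam0] at h1
      linarith
    have h6 : K * lam ^ (2 * a) ≤ (z ^ (2 * a) * absTail μ z) * lam ^ (2 * a) := by
      calc _ ≤ _ := hy
        _ ≤ (lam ^ (2 * a) * z ^ (2 * a)) * absTail μ z :=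
          mul_le_mul h5 h4 (absTail_nonneg _ _) (by positivity)
        _ = _ := by ring
    exact le_of_mul_le_mul_right h6 (by positivity)
  · intro z h1 h2
    have hz : 0 < z := lt_of_lt_of_le (by positivity) h1
    rw [neg_le_neg_iff] at h2 ⊢
    exact hstep z hz h2

/-- A power bound on the tail gives finite moments of every smaller order. -/
lemma lintegral_abs_rpow_lt_top_of_absTail_le {C a p : ℝ} (hp : 0 < p) (hpa : p < a)
    (h : ∀ x, 1 < x → absTail μ x ≤ C * x ^ (-a)) :
    ∫⁻ x, ENNReal.ofReal (|x| ^ p) ∂μ < ⊤ := by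
  rw [lintegral_rpow_eq_lintegral_meas_lt_mul μ (ae_of_all _ fun x => abs_nonneg x)
    (by fun_prop) hp]
  refine ENNReal.mul_lt_top ENNReal.ofReal_lt_top ?_
  rw [← Set.Ioc_union_Ioi_eq_Ioi (zero_le_one (α := ℝ))]
  refine (lintegral_union_le _ _ _).trans_lt (ENNReal.add_lt_top.2 ⟨?_, ?_⟩)
  · have hi : IntegrableOn (fun t : ℝ => t ^ (p - 1)) (Set.Ioc 0 1) := by
      rw [← intervalIntegrable_iff_integrableOn_Ioc_of_le zero_le_one]
      exact intervalIntegral.intervalIntegrable_rpow' (by linarith)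
    refine lt_of_le_of_lt (lintegral_mono fun t => ?_) hi.lintegral_lt_top
    calc _ ≤ 1 * ENNReal.ofReal (t ^ (p - 1)) := mul_le_mul_left prob_le_one _
      _ = _ := one_mul _
  · have hi : IntegrableOn (fun t : ℝ => C * t ^ (p - 1 - a)) (Set.Ioi 1) :=
      (integrableOn_Ioi_rpow_of_lt (by linarith) one_pos).const_mul C
    refine lt_of_le_of_lt (setLIntegral_mono' measurableSet_Ioi fun t ht => ?_) hi.lintegral_lt_top
    have ht0 : 0 < t := lt_trans one_pos ht
    have e : μ {y : ℝ | t < |y|} = ENNReal.ofReal (absTail μ t) :=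
      (ENNReal.ofReal_toReal (measure_ne_top _ _)).symm
    rw [e, ← ENNReal.ofReal_mul (absTail_nonneg _ _)]
    refine ENNReal.ofReal_le_ofReal ?_
    calc _ ≤ C * t ^ (-a) * t ^ (p - 1) :=
          mul_le_mul_of_nonneg_right (h t ht) (Real.rpow_nonneg ht0.le _)
      _ = C * t ^ (p - 1 - a) := by
          rw [mul_assoc, ← Real.rpow_add ht0]; ring_nf

end Tail

/-! ### Clarkson's inequality and the infinite moment of order `α` -/

/-- Writing `t ^ s = t * t ^ (s - 1)`, the second factor is strictly decreasing. -/
lemma add_sq_rpow_lt {s u v : ℝ} (hs1 : s < 1) (hu : u ≠ 0) (hv : v ≠ 0) :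
    (u ^ 2 + v ^ 2) ^ s < (u ^ 2) ^ s + (v ^ 2) ^ s := by
  have hu2 : 0 < u ^ 2 := by positivity
  have hv2 : 0 < v ^ 2 := by positivity
  have e : ∀ x : ℝ, 0 < x → x ^ s = x * x ^ (s - 1) := fun x hx => by
    rw [Real.rpow_sub_one hx.ne']; field_simp
  rw [e _ (add_pos hu2 hv2), e _ hu2, e _ hv2, add_mul]
  have h1 : (u ^ 2 + v ^ 2) ^ (s - 1) < (u ^ 2) ^ (s - 1) :=
    Real.rpow_lt_rpow_of_neg hu2 (by linarith) (by linarith)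
  have h2 : (u ^ 2 + v ^ 2) ^ (s - 1) < (v ^ 2) ^ (s - 1) :=
    Real.rpow_lt_rpow_of_neg hv2 (by linarith) (by linarith)
  exact add_lt_add (mul_lt_mul_of_pos_left h1 hu2) (mul_lt_mul_of_pos_left h2 hv2)

lemma abs_rpow_eq_sq_rpow (x r : ℝ) : |x| ^ r = (x ^ 2) ^ (r / 2) := by
  rw [← sq_abs, ← Real.rpow_natCast, ← Real.rpow_mul (abs_nonneg x)]
  congr 1
  push_cast
  ring

/-- Concavity of `t ^ (r / 2)` combined with the parallelogram law. -/
lemma abs_add_rpow_add_abs_sub_rpow_le {r : ℝ} (hr0 : 0 < r) (hr2 : r < 2) (u v : ℝ) :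
    |u + v| ^ r + |u - v| ^ r ≤ 2 * (u ^ 2 + v ^ 2) ^ (r / 2) := by
  rw [abs_rpow_eq_sq_rpow (u + v), abs_rpow_eq_sq_rpow (u - v)]
  have h := (Real.concaveOn_rpow (p := r / 2) (by linarith) (by linarith)).2
    (Set.mem_Ici.2 (sq_nonneg (u + v))) (Set.mem_Ici.2 (sq_nonneg (u - v)))
    (by norm_num : (0 : ℝ) ≤ 1 / 2) (by norm_num : (0 : ℝ) ≤ 1 / 2) (by norm_num)
  simp only [smul_eq_mul] at h
  rw [show 1 / 2 * (u + v) ^ 2 + 1 / 2 * (u - v) ^ 2 = u ^ 2 + v ^ 2 by ring] at h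
  linarith

/-- A strict form of Clarkson's inequality for exponents below two. -/
lemma abs_add_rpow_add_abs_sub_rpow_lt {r : ℝ} (hr0 : 0 < r) (hr2 : r < 2) {u v : ℝ}
    (hu : u ≠ 0) (hv : v ≠ 0) :
    |u + v| ^ r + |u - v| ^ r < 2 * (|u| ^ r + |v| ^ r) := by
  have h1 := abs_add_rpow_add_abs_sub_rpow_le hr0 hr2 u v
  have h2 := add_sq_rpow_lt (s := r / 2) (by linarith) hu hv
  rw [abs_rpow_eq_sq_rpow u, abs_rpow_eq_sq_rpow v]
  linarith

lemma abs_add_rpow_add_abs_sub_rpow_le' {r : ℝ} (hr0 : 0 < r) (hr2 : r < 2) (u v : ℝ) :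
    |u + v| ^ r + |u - v| ^ r ≤ 2 * (|u| ^ r + |v| ^ r) := by
  by_cases hu : u = 0
  · subst hu; simp [Real.zero_rpow hr0.ne']; linarith
  by_cases hv : v = 0
  · subst hv; simp [Real.zero_rpow hr0.ne']; linarith
  exact (abs_add_rpow_add_abs_sub_rpow_lt hr0 hr2 hu hv).le

lemma abs_add_rpow_le {r : ℝ} (hr0 : 0 < r) (u v : ℝ) :
    |u + v| ^ r ≤ 2 ^ r * (|u| ^ r + |v| ^ r) := by
  have h1 : |u + v| ≤ 2 * max |u| |v| :=
    (abs_add_le u v).trans (by linarith [le_max_left |u| |v|, le_max_right |u| |v|])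
  have hm : 0 ≤ max |u| |v| := (abs_nonneg u).trans (le_max_left _ _)
  refine (Real.rpow_le_rpow (abs_nonneg _) h1 hr0.le).trans ?_
  rw [Real.mul_rpow zero_le_two hm]
  refine mul_le_mul_of_nonneg_left ?_ (by positivity)
  have hu := Real.rpow_nonneg (abs_nonneg u) r
  have hv := Real.rpow_nonneg (abs_nonneg v) r
  rcases max_choice |u| |v| with h | h <;> rw [h] <;> linarith

section Symmetric

/-- A symmetric law reproduced by convolution up to dilation by `c`, with `c ^ r = 2` and `r < 2`,
and with a finite moment of order `r`, is concentrated at the origin. -/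
lemma ae_eq_zero_of_integrable_of_symm {ν : Measure ℝ} [IsProbabilityMeasure ν] {c r : ℝ}
    (hc : 0 < c) (hr0 : 0 < r) (hr2 : r < 2) (hcr : c ^ r = 2)
    (hν : ν.conv ν = ν.map (fun x => c * x)) (hsymm : ν.map (fun x => -x) = ν)
    (hint : Integrable (fun x => |x| ^ r) ν) : ∀ᵐ x ∂ν, x = 0 := by
  have hmeas : Measurable (fun x : ℝ => |x| ^ r) := by fun_prop
  have i1 : Integrable (fun p : ℝ × ℝ => |p.1| ^ r) (ν.prod ν) := hint.comp_fst ν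
  have i2 : Integrable (fun p : ℝ × ℝ => |p.2| ^ r) (ν.prod ν) := hint.comp_snd ν
  have i3 : Integrable (fun p : ℝ × ℝ => |p.1 + p.2| ^ r) (ν.prod ν) := by
    refine ((i1.add i2).const_mul (2 ^ r)).mono'
      (Measurable.aestronglyMeasurable (by fun_prop)) (ae_of_all _ fun p => ?_)
    rw [Real.norm_of_nonneg (Real.rpow_nonneg (abs_nonneg _) _)]
    exact abs_add_rpow_le hr0 _ _
  have i4 : Integrable (fun p : ℝ × ℝ => |p.1 - p.2| ^ r) (ν.prod ν) := by
    refine ((i1.add i2).const_mul (2 ^ r)).mono'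
      (Measurable.aestronglyMeasurable (by fun_prop)) (ae_of_all _ fun p => ?_)
    rw [Real.norm_of_nonneg (Real.rpow_nonneg (abs_nonneg _) _), sub_eq_add_neg]
    refine (abs_add_rpow_le hr0 _ _).trans (le_of_eq ?_)
    rw [abs_neg]
    rfl
  have e1 : ∫ p, |p.1| ^ r ∂(ν.prod ν) = ∫ x, |x| ^ r ∂ν := by
    simpa using integral_fun_fst (μ := ν) (ν := ν) (fun x : ℝ => |x| ^ r)
  have e2 : ∫ p, |p.2| ^ r ∂(ν.prod ν) = ∫ x, |x| ^ r ∂ν := by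
    simpa using integral_fun_snd (μ := ν) (ν := ν) (fun x : ℝ => |x| ^ r)
  have e3 : ∫ p, |p.1 + p.2| ^ r ∂(ν.prod ν) = 2 * ∫ x, |x| ^ r ∂ν := by
    have h1 : ∫ x, |x| ^ r ∂(ν.conv ν) = ∫ p, |p.1 + p.2| ^ r ∂(ν.prod ν) := by
      rw [Measure.conv, integral_map (by fun_prop) hmeas.aestronglyMeasurable]
    rw [← h1, hν, integral_map (by fun_prop) hmeas.aestronglyMeasurable, ← integral_const_mul]
    refine integral_congr_ae (ae_of_all _ fun x => ?_)
    simp only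
    rw [abs_mul, Real.mul_rpow (abs_nonneg _) (abs_nonneg _), abs_of_pos hc, hcr]
  have e4 : ∫ p, |p.1 - p.2| ^ r ∂(ν.prod ν) = 2 * ∫ x, |x| ^ r ∂ν := by
    rw [← e3]
    have hmp : MeasurePreserving (Prod.map id (fun x : ℝ => -x)) (ν.prod ν) (ν.prod ν) :=
      (MeasurePreserving.id ν).prod ⟨measurable_neg, hsymm⟩
    conv_rhs => rw [← hmp.map_eq]
    rw [integral_map hmp.measurable.aemeasurable
      (Measurable.aestronglyMeasurable (by fun_prop))]
    simp [sub_eq_add_neg]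
  -- The deficit in Clarkson's inequality. Its integral vanishes because `c ^ r = 2` and symmetry
  -- give `|u + v| ^ r` and `|u - v| ^ r` the same mean as `|u| ^ r + |v| ^ r`; it is positive off
  -- the axes.
  set G : ℝ × ℝ → ℝ := fun p =>
    2 * (|p.1| ^ r + |p.2| ^ r) - (|p.1 + p.2| ^ r + |p.1 - p.2| ^ r) with hG
  have hG0 : 0 ≤ G := fun p => by
    have := abs_add_rpow_add_abs_sub_rpow_le' hr0 hr2 p.1 p.2
    simp only [hG, Pi.zero_apply]
    linarith
  have i12 : Integrable (fun p : ℝ × ℝ => 2 * (|p.1| ^ r + |p.2| ^ r)) (ν.prod ν) :=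
    (i1.add i2).const_mul 2
  have i34 : Integrable (fun p : ℝ × ℝ => |p.1 + p.2| ^ r + |p.1 - p.2| ^ r) (ν.prod ν) :=
    i3.add i4
  have iG : Integrable G (ν.prod ν) := i12.sub i34
  have hGint : ∫ p, G p ∂(ν.prod ν) = 0 := by
    simp only [hG]
    rw [integral_sub i12 i34, integral_const_mul,
      integral_add i1 i2, integral_add i3 i4, e1, e2, e3, e4]
    ring
  have hGae := (integral_eq_zero_iff_of_nonneg hG0 iG).1 hGint
  have hz : (ν.prod ν) ({0}ᶜ ×ˢ {0}ᶜ) = 0 := by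
    refine measure_mono_null ?_ (ae_iff.1 hGae)
    rintro ⟨u, v⟩ ⟨hu, hv⟩
    have := abs_add_rpow_add_abs_sub_rpow_lt hr0 hr2 (u := u) (v := v) hu hv
    simp only [Set.mem_ofPred_eq, hG, Pi.zero_apply]
    linarith
  rw [Measure.prod_prod, mul_self_eq_zero] at hz
  exact ae_iff.2 hz

/-- A non-degenerate law reproduced by convolution up to dilation by `c`, with `c ^ r = 2` and
`r < 2`, has no finite moment of order `r`. -/
lemma lintegral_abs_rpow_eq_top {μ : Measure ℝ} [IsProbabilityMeasure μ] {c r : ℝ}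
    (hc : 0 < c) (hr0 : 0 < r) (hr2 : r < 2) (hcr : c ^ r = 2)
    (hμ : μ.conv μ = μ.map (fun x => c * x)) (hnd : ∀ y, ¬ ∀ᵐ x ∂μ, x = y) :
    ∫⁻ x, ENNReal.ofReal (|x| ^ r) ∂μ = ⊤ := by
  by_contra hfin
  have hmeas : Measurable (fun x : ℝ => |x| ^ r) := by fun_prop
  have hint : Integrable (fun x => |x| ^ r) μ :=
    (lintegral_ofReal_ne_top_iff_integrable hmeas.aestronglyMeasurable
      (ae_of_all _ fun x => Real.rpow_nonneg (abs_nonneg x) r)).1 hfin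
  set σ : Measure ℝ := μ.map (fun x => -x) with hσ
  have : IsProbabilityMeasure σ := Measure.isProbabilityMeasure_map (by fun_prop)
  have hintσ : Integrable (fun x => |x| ^ r) σ := by
    rw [hσ, integrable_map_measure hmeas.aestronglyMeasurable (by fun_prop)]
    simpa [Function.comp_def] using hint
  let L : ℝ → ℝ →+ ℝ := fun a => AddMonoidHom.mulLeft a
  have hL : ∀ a (ρ₁ ρ₂ : Measure ℝ) [IsProbabilityMeasure ρ₁] [IsProbabilityMeasure ρ₂],
      (ρ₁.conv ρ₂).map (fun x => a * x) =
        (ρ₁.map (fun x => a * x)).conv (ρ₂.map (fun x => a * x)) := by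
    intro a ρ₁ ρ₂ _ _
    exact Measure.map_conv_addMonoidHom (L a) (measurable_const_mul a)
  have hneg : (fun x : ℝ => -x) = fun x => (-1) * x := by ext; ring
  have hσσ : σ.conv σ = σ.map (fun x => c * x) := by
    rw [hσ, hneg, ← hL, hμ, Measure.map_map (by fun_prop) (by fun_prop),
      Measure.map_map (by fun_prop) (by fun_prop)]
    congr 1
    ext x
    simp
  have hσneg : σ.map (fun x => -x) = μ := by
    rw [hσ, Measure.map_map (by fun_prop) (by fun_prop)]
    simp
  -- Symmetrization: `μ.conv σ` is the law of the difference of two independent copies, and it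
  -- inherits the convolution identity.
  have hν : (μ.conv σ).conv (μ.conv σ) = (μ.conv σ).map (fun x => c * x) := by
    rw [hL, ← hμ, ← hσσ, Measure.conv_assoc, ← Measure.conv_assoc σ μ σ, Measure.conv_comm σ μ,
      Measure.conv_assoc μ σ σ, ← Measure.conv_assoc μ μ]
  have hsymm : (μ.conv σ).map (fun x => -x) = μ.conv σ := by
    have h := hL (-1) μ σ
    rw [← hneg, hσneg, ← hσ, Measure.conv_comm σ μ] at h
    exact h
  have hintν : Integrable (fun x => |x| ^ r) (μ.conv σ) := by
    rw [Measure.conv, integrable_map_measure hmeas.aestronglyMeasurable (by fun_prop)]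
    refine (((hint.comp_fst σ).add (hintσ.comp_snd μ)).const_mul (2 ^ r)).mono'
      (Measurable.aestronglyMeasurable (by fun_prop))
      (ae_of_all _ fun p => ?_)
    simp only [Function.comp_apply]
    rw [Real.norm_of_nonneg (Real.rpow_nonneg (abs_nonneg _) _)]
    exact abs_add_rpow_le hr0 _ _
  have h0 := ae_eq_zero_of_integrable_of_symm hc hr0 hr2 hcr hν hsymm hintν
  -- Two independent copies agree almost surely, so by Fubini one of them equals a fixed value
  -- almost surely.
  rw [Measure.conv] at h0
  have h1 := Measure.ae_ae_of_ae_prod (ae_of_ae_map (by fun_prop) h0)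
  obtain ⟨x, hx⟩ := h1.exists
  refine hnd x ?_
  filter_upwards [ae_of_ae_map (by fun_prop) hx] with y hy
  linarith

end Symmetric

/-! ### Deterministic comparison of block sums with single terms -/

lemma sum_range_mul_eq_sum_sum (f : ℕ → ℝ) (m τ : ℕ) :
    ∑ n ∈ Finset.range (m * τ), f n =
      ∑ j ∈ Finset.range m, ∑ i ∈ Finset.range τ, f (j * τ + i) := by
  induction m with
  | zero => simp
  | succ m ih => rw [Nat.succ_mul, Finset.sum_range_add, ih, Finset.sum_range_succ]

lemma sum_rpow_le_sum_rpow {ι : Type*} (s : Finset ι) (w : ι → ℝ) (hw : ∀ i ∈ s, 0 ≤ w i) {r : ℝ}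
    (hr0 : 0 < r) (hr1 : r ≤ 1) : (∑ i ∈ s, w i) ^ r ≤ ∑ i ∈ s, w i ^ r := by
  classical
  induction s using Finset.induction_on with
  | empty => simp [Real.zero_rpow hr0.ne']
  | insert a s ha ih =>
    rw [Finset.sum_insert ha, Finset.sum_insert ha]
    have h1 : ∀ i ∈ s, 0 ≤ w i := fun i hi => hw i (Finset.mem_insert_of_mem hi)
    refine (Real.rpow_add_le_add_rpow (hw a (Finset.mem_insert_self _ _))
      (Finset.sum_nonneg h1) hr0.le hr1).trans ?_
    linarith [ih h1]

section Sphere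

variable {τ : ℕ}

/-- The power of a sum differs from the sum of powers by an arbitrarily small multiple of the
latter, up to a multiple of the products of distinct terms. -/
lemma exists_abs_sum_rpow_sub_le {q : ℝ} (hq : 0 < q) {ε : ℝ} (hε : 0 < ε) :
    ∃ C : ℝ, 0 ≤ C ∧ ∀ x : Fin τ → ℝ,
      |(|∑ i, x i| ^ q - ∑ i, |x i| ^ q)| ≤ ε * ∑ i, |x i| ^ q +
        C * ∑ p ∈ (Finset.univ : Finset (Fin τ)).offDiag, (|x p.1| * |x p.2|) ^ (q / 2) := by
  set F : (Fin τ → ℝ) → ℝ := fun x => |(|∑ i, x i| ^ q - ∑ i, |x i| ^ q)| with hF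
  set S : (Fin τ → ℝ) → ℝ := fun x => ∑ i, |x i| ^ q with hS
  set G : (Fin τ → ℝ) → ℝ := fun x =>
    ∑ p ∈ (Finset.univ : Finset (Fin τ)).offDiag, (|x p.1| * |x p.2|) ^ (q / 2) with hG
  have hpow : ∀ s : ℝ, 0 < s → Continuous fun y : ℝ => |y| ^ s := fun s hs =>
    continuous_abs.rpow_const fun _ => Or.inr hs.le
  have hScont : Continuous S := continuous_finsetSum _ fun i _ =>
    (hpow q hq).comp (continuous_apply i)
  have hFcont : Continuous F := by
    refine continuous_abs.comp (Continuous.sub ?_ hScont)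
    exact (hpow q hq).comp (continuous_finsetSum _ fun i _ => continuous_apply i)
  have hGcont : Continuous G := continuous_finsetSum _ fun p _ => by
    refine Continuous.rpow_const ?_ fun _ => Or.inr (by linarith)
    exact (continuous_abs.comp (continuous_apply _)).mul (continuous_abs.comp (continuous_apply _))
  have hS0 : ∀ x, 0 ≤ S x := fun x =>
    Finset.sum_nonneg fun i _ => Real.rpow_nonneg (abs_nonneg _) _
  have hG0 : ∀ x, 0 ≤ G x := fun x =>
    Finset.sum_nonneg fun p _ => Real.rpow_nonneg (mul_nonneg (abs_nonneg _) (abs_nonneg _)) _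
  have hFhom : ∀ (t : ℝ) (x), 0 ≤ t → F (t • x) = t ^ q * F x := by
    intro t x ht
    simp only [hF, Pi.smul_apply, smul_eq_mul]
    rw [← Finset.mul_sum, abs_mul, abs_of_nonneg ht, Real.mul_rpow ht (abs_nonneg _)]
    simp_rw [abs_mul, abs_of_nonneg ht, Real.mul_rpow ht (abs_nonneg _)]
    rw [← Finset.mul_sum, ← mul_sub, abs_mul, abs_of_nonneg (Real.rpow_nonneg ht _)]
  have hShom : ∀ (t : ℝ) (x), 0 ≤ t → S (t • x) = t ^ q * S x := by
    intro t x ht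
    simp only [hS, Pi.smul_apply, smul_eq_mul, abs_mul, abs_of_nonneg ht,
      Real.mul_rpow ht (abs_nonneg _), ← Finset.mul_sum]
  have hGhom : ∀ (t : ℝ) (x), 0 ≤ t → G (t • x) = t ^ q * G x := by
    intro t x ht
    simp only [hG, Pi.smul_apply, smul_eq_mul, abs_mul, abs_of_nonneg ht, Finset.mul_sum]
    refine Finset.sum_congr rfl fun p _ => ?_
    rw [mul_mul_mul_comm, Real.mul_rpow (mul_nonneg ht ht)
      (mul_nonneg (abs_nonneg _) (abs_nonneg _)), Real.mul_rpow ht ht, ← Real.rpow_add_of_nonneg ht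
      (by linarith) (by linarith), add_halves]
  -- If all products of distinct coordinates vanish, only one coordinate is nonzero, and then `F x =
  -- 0 < ε * S x`.
  have hGpos : ∀ x, x ≠ 0 → ε * S x ≤ F x → 0 < G x := by
    intro x hx hle
    refine lt_of_le_of_ne (hG0 x) fun h0 => ?_
    obtain ⟨i, hi⟩ := Function.ne_iff.1 hx
    have hz : ∀ k, k ≠ i → x k = 0 := by
      intro k hk
      have h1 := (Finset.sum_eq_zero_iff_of_nonneg fun p _ =>
        Real.rpow_nonneg (mul_nonneg (abs_nonneg _) (abs_nonneg _)) _).1 h0.symm (k, i)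
        (by simp [hk])
      rw [Real.rpow_eq_zero (mul_nonneg (abs_nonneg _) (abs_nonneg _)) (by linarith)] at h1
      simpa [show x i ≠ 0 from hi] using h1
    have h2 : ∑ k, x k = x i := Finset.sum_eq_single i (fun k _ hk => hz k hk) (by simp)
    have h3 : S x = |x i| ^ q :=
      Finset.sum_eq_single i (fun k _ hk => by simp [hz k hk, Real.zero_rpow hq.ne']) (by simp)
    have h4 : F x = 0 := by
      have : F x = |(|∑ k, x k| ^ q - S x)| := rfl
      rw [this, h2, h3, sub_self, abs_zero]
    have h5 : 0 < S x := by rw [h3]; exact Real.rpow_pos_of_pos (abs_pos.2 hi) _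
    nlinarith
  -- Since `F`, `S`, `G` are all homogeneous of degree `q`, the unit sphere suffices. On its compact
  -- part where `ε * S ≤ F`, `G` is bounded below by a positive constant.
  have hK : IsCompact (Metric.sphere (0 : Fin τ → ℝ) 1 ∩ {x | ε * S x ≤ F x}) :=
    (isCompact_sphere _ _).inter_right (isClosed_le (hScont.const_mul ε) hFcont)
  obtain ⟨C, hC0, hC⟩ : ∃ C : ℝ, 0 ≤ C ∧
      ∀ x ∈ Metric.sphere (0 : Fin τ → ℝ) 1 ∩ {x | ε * S x ≤ F x}, F x ≤ C * G x := by
    rcases (Metric.sphere (0 : Fin τ → ℝ) 1 ∩ {x | ε * S x ≤ F x}).eq_empty_or_nonempty with h | h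
    · exact ⟨0, le_rfl, by simp [h]⟩
    · obtain ⟨y, hy, hymin⟩ := hK.exists_isMinOn h hGcont.continuousOn
      obtain ⟨z, hz, hzmax⟩ := hK.exists_isMaxOn h hFcont.continuousOn
      have hGy : 0 < G y := hGpos y (ne_zero_of_mem_unit_sphere ⟨y, hy.1⟩) hy.2
      refine ⟨F z / G y, div_nonneg (abs_nonneg _) hGy.le, fun x hx => ?_⟩
      have h1 : G y ≤ G x := hymin hx
      have h2 : F x ≤ F z := hzmax hx
      calc F x ≤ F z := h2
        _ = F z / G y * G y := by field_simp
        _ ≤ _ := mul_le_mul_of_nonneg_left h1 (div_nonneg (abs_nonneg _) hGy.le)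
  have hsph : ∀ x ∈ Metric.sphere (0 : Fin τ → ℝ) 1, F x ≤ ε * S x + C * G x := by
    intro x hx
    by_cases h : ε * S x ≤ F x
    · linarith [hC x ⟨hx, h⟩, mul_nonneg hε.le (hS0 x)]
    · linarith [mul_nonneg hC0 (hG0 x)]
  refine ⟨C, hC0, fun x => ?_⟩
  change F x ≤ ε * S x + C * G x
  by_cases hx : x = 0
  · have h1 : F x = 0 := by simp [hF, hx, Real.zero_rpow hq.ne']
    rw [h1]
    exact add_nonneg (mul_nonneg hε.le (hS0 x)) (mul_nonneg hC0 (hG0 x))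
  · have hn : ‖x‖ ≠ 0 := norm_ne_zero_iff.2 hx
    have hxe : x = ‖x‖ • (‖x‖⁻¹ • x) := by rw [smul_smul, mul_inv_cancel₀ hn, one_smul]
    have hmem : ‖x‖⁻¹ • x ∈ Metric.sphere (0 : Fin τ → ℝ) 1 := by
      rw [mem_sphere_zero_iff_norm, norm_smul, norm_inv, norm_norm, inv_mul_cancel₀ hn]
    rw [hxe, hFhom _ _ (norm_nonneg x), hShom _ _ (norm_nonneg x), hGhom _ _ (norm_nonneg x)]
    have := mul_le_mul_of_nonneg_left (hsph _ hmem) (Real.rpow_nonneg (norm_nonneg x) q)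
    linarith

end Sphere

/-- If the products of distinct terms inside the blocks of length `τ` are negligible with respect
to the sum of the `q`-th powers, then summing `q`-th powers of block sums or of single terms is
asymptotically the same. -/
lemma tendsto_sum_block_rpow_div {x : ℕ → ℝ} {τ : ℕ} {q ρ : ℝ} (hτ : 0 < τ) (hq : 0 < q)
    (hρ : 0 ≤ ρ)
    (hden : Tendsto (fun N : ℕ => (∑ n ∈ Finset.range N, |x n| ^ q) / (N : ℝ) ^ ρ) atTop atTop)
    (hcross : ∀ a b : ℕ, a < τ → b < τ → a ≠ b → ∃ C : ℝ, ∀ m : ℕ,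
      ∑ j ∈ Finset.range m, (|x (j * τ + a)| * |x (j * τ + b)|) ^ (q / 2) ≤ C * (m : ℝ) ^ ρ) :
    Tendsto (fun m : ℕ => (∑ j ∈ Finset.range m, |∑ i ∈ Finset.range τ, x (j * τ + i)| ^ q) /
      ∑ n ∈ Finset.range (m * τ), |x n| ^ q) atTop (𝓝 1) := by
  set D : ℕ → ℝ := fun N => ∑ n ∈ Finset.range N, |x n| ^ q with hD
  set B : ℕ → ℝ := fun m => ∑ j ∈ Finset.range m, |∑ i ∈ Finset.range τ, x (j * τ + i)| ^ q with hB
  have hmul : Tendsto (fun m : ℕ => m * τ) atTop atTop :=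
    tendsto_id.atTop_mul_const' hτ
  have hden2 : Tendsto (fun m : ℕ => ((m * τ : ℕ) : ℝ) ^ ρ / D (m * τ)) atTop (𝓝 0) := by
    have := (tendsto_inv_atTop_zero.comp hden).comp hmul
    refine this.congr fun m => ?_
    simp [hD]
  have hDpos : ∀ᶠ m : ℕ in atTop, 0 < D (m * τ) := by
    filter_upwards [(hden.comp hmul).eventually_gt_atTop 0] with m hm
    have hDn : 0 ≤ D (m * τ) := Finset.sum_nonneg fun i _ => Real.rpow_nonneg (abs_nonneg _) _
    refine lt_of_le_of_ne hDn fun h => ?_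
    simp only [Function.comp_apply] at hm
    change 0 < D (m * τ) / _ at hm
    rw [← h, zero_div] at hm
    exact lt_irrefl _ hm
  choose! c hc using hcross
  rw [Metric.tendsto_atTop']
  intro ε hε
  obtain ⟨C, hC0, hC⟩ := exists_abs_sum_rpow_sub_le (τ := τ) hq (half_pos hε)
  set c' : ℝ := ∑ p ∈ (Finset.univ : Finset (Fin τ)).offDiag, |c p.1 p.2| with hc'
  have hc'0 : 0 ≤ c' := Finset.sum_nonneg fun _ _ => abs_nonneg _
  have hbound : ∀ m : ℕ,
      |B m - D (m * τ)| ≤ ε / 2 * D (m * τ) + C * c' * ((m * τ : ℕ) : ℝ) ^ ρ := by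
    intro m
    have e1 : D (m * τ) = ∑ j ∈ Finset.range m, ∑ i : Fin τ, |x (j * τ + i)| ^ q := by
      simp only [hD]
      rw [sum_range_mul_eq_sum_sum]
      exact Finset.sum_congr rfl fun j _ => Finset.sum_range fun i => |x (j * τ + i)| ^ q
    have e2 : B m = ∑ j ∈ Finset.range m, |∑ i : Fin τ, x (j * τ + i)| ^ q :=
      Finset.sum_congr rfl fun j _ => by rw [Finset.sum_range fun i => x (j * τ + i)]
    have h1 : |B m - D (m * τ)| ≤ ∑ j ∈ Finset.range m, (ε / 2 * ∑ i : Fin τ, |x (j * τ + i)| ^ q +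
        C * ∑ p ∈ (Finset.univ : Finset (Fin τ)).offDiag,
          (|x (j * τ + p.1)| * |x (j * τ + p.2)|) ^ (q / 2)) := by
      rw [e1, e2, ← Finset.sum_sub_distrib]
      refine (Finset.abs_sum_le_sum_abs _ _).trans (Finset.sum_le_sum fun j _ => ?_)
      exact hC fun i => x (j * τ + i)
    rw [Finset.sum_add_distrib, ← Finset.mul_sum, ← e1, ← Finset.mul_sum, Finset.sum_comm] at h1
    refine h1.trans ?_
    rw [mul_assoc]
    refine add_le_add le_rfl (mul_le_mul_of_nonneg_left ?_ hC0)
    rw [hc', Finset.sum_mul]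
    refine Finset.sum_le_sum fun p hp => ?_
    have hne : (p.1 : ℕ) ≠ p.2 := fun h => (Finset.mem_offDiag.1 hp).2.2 (Fin.ext h)
    refine (hc p.1 p.2 p.1.2 p.2.2 hne m).trans ?_
    refine mul_le_mul (le_abs_self _) (Real.rpow_le_rpow (by positivity) ?_ hρ) (by positivity)
      (abs_nonneg _)
    exact_mod_cast Nat.le_mul_of_pos_right m hτ
  have hlim : Tendsto (fun m : ℕ => C * c' * (((m * τ : ℕ) : ℝ) ^ ρ / D (m * τ))) atTop (𝓝 0) := by
    simpa using hden2.const_mul (C * c')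
  have hev := (hlim.eventually_lt_const (half_pos hε)).and hDpos
  obtain ⟨m₀, hm₀⟩ := eventually_atTop.1 hev
  refine ⟨m₀, fun m hm => ?_⟩
  obtain ⟨h1, h2⟩ := hm₀ m hm.le
  change dist (B m / D (m * τ)) 1 < ε
  rw [Real.dist_eq, show B m / D (m * τ) - 1 = (B m - D (m * τ)) / D (m * τ) by field_simp,
    abs_div, abs_of_pos h2, div_lt_iff₀ h2]
  rw [← mul_div_assoc, div_lt_iff₀ h2] at h1
  linarith [hbound m]

/-! ### Almost sure growth of i.i.d. sums -/

section Sequences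

variable {Ω : Type*} [MeasurableSpace Ω] {P : Measure Ω} [IsProbabilityMeasure P]

/-- Strong law of large numbers for nonnegative variables with infinite mean. -/
lemma ae_tendsto_average_atTop {Y : ℕ → Ω → ℝ} (hm : ∀ n, Measurable (Y n))
    (h0 : ∀ n ω, 0 ≤ Y n ω) (hindep : Pairwise fun i j => IndepFun (Y i) (Y j) P)
    (hident : ∀ n, IdentDistrib (Y n) (Y 0) P P) (hinf : ∫⁻ ω, ENNReal.ofReal (Y 0 ω) ∂P = ⊤) :
    ∀ᵐ ω ∂P, Tendsto (fun n : ℕ => (∑ i ∈ Finset.range n, Y i ω) / n) atTop atTop := by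
  -- Truncated means: the strong law applies at every level `M`, and monotone convergence makes `e`
  -- unbounded.
  set e : ℕ → ℝ := fun M => ∫ ω, min (Y 0 ω) M ∂P with he
  have hmmin : ∀ M : ℕ, Measurable fun y : ℝ => min y M := fun M => by fun_prop
  have hint : ∀ M : ℕ, Integrable (fun ω => min (Y 0 ω) M) P := fun M => by
    refine Integrable.of_bound ((hmmin M).comp (hm 0)).aestronglyMeasurable (M : ℝ)
      (ae_of_all _ fun ω => ?_)
    rw [Real.norm_of_nonneg (le_min (h0 _ _) (Nat.cast_nonneg _))]
    exact min_le_right _ _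
  have hslln : ∀ᵐ ω ∂P, ∀ M : ℕ,
      Tendsto (fun n : ℕ => (∑ i ∈ Finset.range n, min (Y i ω) M) / n) atTop (𝓝 (e M)) := by
    rw [ae_all_iff]
    intro M
    exact strong_law_ae_real (fun n ω => min (Y n ω) M) (hint M)
      (fun i j hij => (hindep hij).comp (hmmin M) (hmmin M)) (fun n => (hident n).comp (hmmin M))
  have hunb : ∀ A : ℝ, ∃ M : ℕ, A < e M := by
    by_contra! hcon
    obtain ⟨A, hA⟩ := hcon
    have hmono : Tendsto (fun M : ℕ => ∫⁻ ω, ENNReal.ofReal (min (Y 0 ω) M) ∂P) atTop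
        (𝓝 (∫⁻ ω, ENNReal.ofReal (Y 0 ω) ∂P)) := by
      refine lintegral_tendsto_of_tendsto_of_monotone
        (fun M => ((hmmin M).comp (hm 0)).ennreal_ofReal.aemeasurable)
        (ae_of_all _ fun ω M N h => ENNReal.ofReal_le_ofReal
          (min_le_min le_rfl (by exact_mod_cast h))) (ae_of_all _ fun ω => ?_)
      refine (ENNReal.continuous_ofReal.tendsto _).comp (tendsto_const_nhds.congr' ?_)
      filter_upwards [tendsto_natCast_atTop_atTop.eventually_ge_atTop (Y 0 ω)] with M hM
      exact (min_eq_left hM).symm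
    rw [hinf] at hmono
    have hle : ∀ M : ℕ, ∫⁻ ω, ENNReal.ofReal (min (Y 0 ω) M) ∂P ≤ ENNReal.ofReal A := fun M => by
      rw [← ofReal_integral_eq_lintegral_ofReal (hint M)
        (ae_of_all _ fun ω => le_min (h0 _ _) (Nat.cast_nonneg _))]
      exact ENNReal.ofReal_le_ofReal (hA M)
    exact absurd (le_of_tendsto' hmono hle) (by simp)
  filter_upwards [hslln] with ω hω
  rw [tendsto_atTop]
  intro A
  obtain ⟨M, hM⟩ := hunb A
  filter_upwards [(hω M).eventually_const_lt hM] with n hn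
  refine hn.le.trans (div_le_div_of_nonneg_right ?_ (Nat.cast_nonneg _))
  exact Finset.sum_le_sum fun i _ => min_le_left _ _

omit [IsProbabilityMeasure P] in
/-- Partial sums of nonnegative variables with a finite moment of order `r ≤ 1` grow at most like
`m ^ (1 / r)`. -/
lemma ae_exists_sum_le_rpow {Y : ℕ → Ω → ℝ} {r : ℝ} (hr0 : 0 < r) (hr1 : r ≤ 1)
    (h0 : ∀ n ω, 0 ≤ Y n ω) (hint : Integrable (fun ω => Y 0 ω ^ r) P)
    (hindep : Pairwise fun i j => IndepFun (Y i) (Y j) P)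
    (hident : ∀ n, IdentDistrib (Y n) (Y 0) P P) :
    ∀ᵐ ω ∂P, ∃ C : ℝ, ∀ m : ℕ, ∑ j ∈ Finset.range m, Y j ω ≤ C * (m : ℝ) ^ (1 / r) := by
  have hpow : Measurable fun y : ℝ => y ^ r := by fun_prop
  -- Subadditivity of `t ^ r` bounds `(∑ Y) ^ r` by `∑ Y ^ r`, which is `O(m)` by the strong law.
  filter_upwards [strong_law_ae_real (fun n ω => Y n ω ^ r) hint
    (fun i j hij => (hindep hij).comp hpow hpow) fun n => (hident n).comp hpow] with ω hω
  obtain ⟨A, hA⟩ := hω.bddAbove_range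
  refine ⟨A ^ (1 / r), fun m => ?_⟩
  have hs0 : 0 ≤ ∑ j ∈ Finset.range m, Y j ω := Finset.sum_nonneg fun i _ => h0 i ω
  rcases Nat.eq_zero_or_pos m with rfl | hm
  · simp [Real.zero_rpow (inv_pos.2 hr0).ne']
  have hm0 : (0 : ℝ) < m := by exact_mod_cast hm
  have h1 : (∑ j ∈ Finset.range m, Y j ω ^ r) / m ≤ A := hA ⟨m, rfl⟩
  have hA0 : 0 ≤ A := le_trans (div_nonneg (Finset.sum_nonneg fun i _ =>
    Real.rpow_nonneg (h0 i ω) _) hm0.le) h1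
  rw [div_le_iff₀ hm0] at h1
  have h2 := (sum_rpow_le_sum_rpow (Finset.range m) (fun j => Y j ω) (fun i _ => h0 i ω)
    hr0 hr1).trans h1
  rw [← Real.mul_rpow hA0 hm0.le]
  calc ∑ j ∈ Finset.range m, Y j ω = ((∑ j ∈ Finset.range m, Y j ω) ^ r) ^ (1 / r) := by
        rw [← Real.rpow_mul hs0, mul_one_div_cancel hr0.ne', Real.rpow_one]
    _ ≤ _ := Real.rpow_le_rpow (Real.rpow_nonneg hs0 _) h2 (by positivity)

lemma summable_exp_neg_mul_rpow {K κ : ℝ} (hK : 0 < K) (hκ : 0 < κ) :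
    Summable fun n : ℕ => Real.exp (-K * (n : ℝ) ^ κ) := by
  -- The exponent `-(2 / κ)` turns into `-2` after substituting `n ^ κ`.
  have h1 := (isLittleO_exp_neg_mul_rpow_atTop hK (-(2 / κ))).comp_tendsto
    ((tendsto_rpow_atTop hκ).comp tendsto_natCast_atTop_atTop)
  refine summable_of_isBigO_nat (g := fun n : ℕ => (n : ℝ) ^ (-2 : ℝ))
    (Real.summable_nat_rpow.2 (by norm_num)) (h1.isBigO.congr_right fun n => ?_)
  simp only [Function.comp_apply]
  rw [← Real.rpow_mul (Nat.cast_nonneg n)]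
  congr 1
  field_simp

variable {μ : Measure ℝ} {ξ : ℕ → Ω → ℝ}

/-- A polynomial lower bound on the tail gives a polynomial lower bound on the partial sums of
absolute powers of an i.i.d. sequence. -/
lemma ae_eventually_rpow_le_sum [IsProbabilityMeasure μ] (hξm : ∀ n, Measurable (ξ n))
    (hξ : iIndepFun ξ P) (hlaw : ∀ n, P.map (ξ n) = μ) {K b x₀ s q : ℝ} (hK : 0 < K)
    (htail : ∀ x, x₀ ≤ x → K * x ^ (-b) ≤ absTail μ x) (hs : 0 < s) (hq : 0 < q)
    (hsb : s * b < q) :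
    ∀ᵐ ω ∂P, ∀ᶠ N : ℕ in atTop, (N : ℝ) ^ s ≤ ∑ n ∈ Finset.range N, |ξ n ω| ^ q := by
  set E : ℕ → Set Ω := fun N => {ω | ∑ n ∈ Finset.range N, |ξ n ω| ^ q < (N : ℝ) ^ s} with hE
  have hprob : ∀ᶠ N : ℕ in atTop,
      P.real (E N) ≤ Real.exp (-K * (N : ℝ) ^ (1 - s * b / q)) := by
    have hlarge : Tendsto (fun N : ℕ => (N : ℝ) ^ (s / q)) atTop atTop :=
      (tendsto_rpow_atTop (by positivity)).comp tendsto_natCast_atTop_atTop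
    filter_upwards [hlarge.eventually_ge_atTop x₀, eventually_gt_atTop 0] with N hN hN0
    have hNpos : (0 : ℝ) < N := by exact_mod_cast hN0
    -- A sum below `N ^ s` forces every term to satisfy `|ξ n| ≤ y`. This has probability at most
    -- `exp (-N * absTail μ y)`, summable in `N` because `s * b < q`; Borel–Cantelli concludes.
    set y := (N : ℝ) ^ (s / q) with hy
    have hyq : y ^ q = (N : ℝ) ^ s := by
      rw [hy, ← Real.rpow_mul hNpos.le]; congr 1; field_simp
    have hsub : E N ⊆ ⋂ n ∈ Finset.range N, ξ n ⁻¹' {z | y < |z|}ᶜ := by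
      intro ω hω
      simp only [Set.mem_iInter, Set.mem_preimage, Set.mem_compl_iff, Set.mem_ofPred_eq, not_lt]
      intro n hn
      by_contra! hlt
      have h1 : y ^ q ≤ |ξ n ω| ^ q := Real.rpow_le_rpow (by positivity) hlt.le hq.le
      have h2 : |ξ n ω| ^ q ≤ ∑ n ∈ Finset.range N, |ξ n ω| ^ q :=
        Finset.single_le_sum (f := fun n => |ξ n ω| ^ q)
          (fun i _ => Real.rpow_nonneg (abs_nonneg _) _) hn
      have h3 : ∑ n ∈ Finset.range N, |ξ n ω| ^ q < (N : ℝ) ^ s := hω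
      linarith
    have hone : ∀ n, P.real (ξ n ⁻¹' {z | y < |z|}ᶜ) = 1 - absTail μ y := by
      intro n
      rw [← map_measureReal_apply (hξm n) (measurableSet_lt_abs y).compl, hlaw,
        probReal_compl_eq_one_sub (measurableSet_lt_abs y)]
      rfl
    have hprod : P.real (⋂ n ∈ Finset.range N, ξ n ⁻¹' {z | y < |z|}ᶜ) = (1 - absTail μ y) ^ N := by
      have := hξ.measure_inter_preimage_eq_mul (Finset.range N)
        (sets := fun _ => {z | y < |z|}ᶜ) fun _ _ => (measurableSet_lt_abs y).compl
      rw [measureReal_def, this, ENNReal.toReal_prod]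
      simp_rw [← measureReal_def, hone]
      simp
    refine (measureReal_mono hsub).trans ?_
    rw [hprod]
    have h4 : 1 - absTail μ y ≤ Real.exp (-absTail μ y) := by
      linarith [Real.add_one_le_exp (-absTail μ y)]
    refine (pow_le_pow_left₀ (by linarith [absTail_le_one μ y]) h4 N).trans ?_
    rw [← Real.exp_nat_mul]
    refine Real.exp_le_exp.2 ?_
    have h5 := mul_le_mul_of_nonneg_left (htail y hN) hNpos.le
    have h6 : (N : ℝ) ^ (1 - s * b / q) = N * y ^ (-b) := by
      rw [hy, ← Real.rpow_mul hNpos.le, sub_eq_add_neg, Real.rpow_add hNpos, Real.rpow_one]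
      congr 2
      ring
    rw [h6]
    linarith
  have hsum : Summable fun N => P.real (E N) := by
    refine summable_of_isBigO_nat (summable_exp_neg_mul_rpow hK
      (by rw [sub_pos, div_lt_one hq]; exact hsb : 0 < 1 - s * b / q)) ?_
    refine Asymptotics.IsBigO.of_bound 1 ?_
    filter_upwards [hprob] with N hN
    rw [Real.norm_of_nonneg measureReal_nonneg, Real.norm_of_nonneg (Real.exp_nonneg _), one_mul]
    exact hN
  have hfin : ∑' N, P (E N) ≠ ⊤ := by
    have h1 : ∀ N, P (E N) = ENNReal.ofReal (P.real (E N)) := fun N =>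
      (ENNReal.ofReal_toReal (measure_ne_top _ _)).symm
    simp_rw [h1]
    exact hsum.tsum_ofReal_ne_top
  filter_upwards [ae_eventually_notMem hfin] with ω hω
  filter_upwards [hω] with N hN
  exact not_lt.1 hN

/-- Control of the products of distinct terms inside the blocks of an i.i.d. sequence. -/
lemma ae_exists_sum_cross_le (hξm : ∀ n, Measurable (ξ n)) (hξ : iIndepFun ξ P)
    (hlaw : ∀ n, P.map (ξ n) = μ) {r s : ℝ} (hr0 : 0 < r) (hr1 : r ≤ 1)
    (hint : Integrable (fun x => |x| ^ (s * r)) μ) {τ a b : ℕ} (ha : a < τ) (hb : b < τ)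
    (hab : a ≠ b) :
    ∀ᵐ ω ∂P, ∃ C : ℝ, ∀ m : ℕ,
      ∑ j ∈ Finset.range m, (|ξ (j * τ + a) ω| * |ξ (j * τ + b) ω|) ^ s ≤
        C * (m : ℝ) ^ (1 / r) := by
  have hinj : ∀ i j a b : ℕ, a < τ → b < τ → (i ≠ j ∨ a ≠ b) → i * τ + a ≠ j * τ + b := by
    intro i j a b ha hb h heq
    have hτ : 0 < τ := by omega
    have h1 : i = j := by
      have := congrArg (· / τ) heq
      simpa [Nat.add_div_of_dvd_right, Nat.mul_div_cancel _ hτ, Nat.div_eq_of_lt ha,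
        Nat.div_eq_of_lt hb] using this
    subst h1
    omega
  have hφ : Measurable fun p : ℝ × ℝ => (|p.1| * |p.2|) ^ s := by fun_prop
  have hpair : ∀ j, P.map (fun ω => (ξ (j * τ + a) ω, ξ (j * τ + b) ω)) = μ.prod μ := by
    intro j
    rw [(indepFun_iff_map_prod_eq_prod_map_map (hξm _).aemeasurable (hξm _).aemeasurable).1
      (hξ.indepFun (hinj j j a b ha hb (Or.inr hab))), hlaw, hlaw]
  have hμ : IsProbabilityMeasure μ := by
    rw [← hlaw 0]; exact Measure.isProbabilityMeasure_map (hξm 0).aemeasurable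
  refine ae_exists_sum_le_rpow (Y := fun j ω => (|ξ (j * τ + a) ω| * |ξ (j * τ + b) ω|) ^ s) hr0 hr1
    (fun n ω => Real.rpow_nonneg (mul_nonneg (abs_nonneg _) (abs_nonneg _)) _) ?_ ?_ ?_
  -- By independence the moment of the product factors, so each factor needs only a moment of order
  -- `s * r`.
  · have h1 : Integrable (fun p : ℝ × ℝ => |p.1| ^ (s * r) * |p.2| ^ (s * r)) (μ.prod μ) :=
      hint.mul_prod hint
    rw [← hpair 0, integrable_map_measure (Measurable.aestronglyMeasurable (by fun_prop))
      (((hξm _).prodMk (hξm _)).aemeasurable)] at h1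
    refine h1.congr (ae_of_all _ fun ω => ?_)
    simp only [Function.comp_apply]
    rw [← Real.rpow_mul (mul_nonneg (abs_nonneg _) (abs_nonneg _)),
      Real.mul_rpow (abs_nonneg _) (abs_nonneg _)]
  · intro i j hij
    exact (hξ.indepFun_prodMk_prodMk hξm (i * τ + a) (i * τ + b) (j * τ + a) (j * τ + b)
      (hinj _ _ _ _ ha ha (Or.inl hij)) (hinj _ _ _ _ ha hb (Or.inl hij))
      (hinj _ _ _ _ hb ha (Or.inl hij)) (hinj _ _ _ _ hb hb (Or.inl hij))).comp hφ hφ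
  · intro n
    have : IdentDistrib (fun ω => (ξ (n * τ + a) ω, ξ (n * τ + b) ω))
        (fun ω => (ξ (0 * τ + a) ω, ξ (0 * τ + b) ω)) P P :=
      ⟨((hξm _).prodMk (hξm _)).aemeasurable, ((hξm _).prodMk (hξm _)).aemeasurable,
        by rw [hpair, hpair]⟩
    exact this.comp hφ

end Sequences

/-! ### Specialization to the dilation factor `2 ^ (1 / α)` -/

section Stable

variable {μ : Measure ℝ} [IsProbabilityMeasure μ] {α : ℝ}

lemma one_lt_two_rpow_inv (hα0 : 0 < α) : (1 : ℝ) < 2 ^ (1 / α) :=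
  Real.one_lt_rpow one_lt_two (one_div_pos.2 hα0)

lemma two_rpow_inv_rpow (α a : ℝ) : ((2 : ℝ) ^ (1 / α)) ^ a = 2 ^ (a / α) := by
  rw [← Real.rpow_mul zero_le_two]
  congr 1
  ring

lemma two_rpow_inv_rpow_lt (hα0 : 0 < α) {a : ℝ} (ha : a < α) : ((2 : ℝ) ^ (1 / α)) ^ a < 2 := by
  rw [two_rpow_inv_rpow]
  calc (2 : ℝ) ^ (a / α) < 2 ^ (1 : ℝ) :=
        Real.rpow_lt_rpow_of_exponent_lt one_lt_two ((div_lt_one hα0).2 ha)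
    _ = 2 := Real.rpow_one 2

lemma lt_two_rpow_inv_rpow (hα0 : 0 < α) {b : ℝ} (hb : α < b) : 2 < ((2 : ℝ) ^ (1 / α)) ^ b := by
  rw [two_rpow_inv_rpow]
  calc (2 : ℝ) = 2 ^ (1 : ℝ) := (Real.rpow_one 2).symm
    _ < 2 ^ (b / α) := Real.rpow_lt_rpow_of_exponent_lt one_lt_two ((one_lt_div hα0).2 hb)

lemma integrable_abs_rpow_of_conv (hα0 : 0 < α)
    (hμ : μ.conv μ = μ.map (fun x => 2 ^ (1 / α) * x)) {p : ℝ} (hp0 : 0 ≤ p) (hp : p < α) :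
    Integrable (fun x => |x| ^ p) μ := by
  rcases hp0.eq_or_lt with rfl | hp0
  · simp
  obtain ⟨a, hpa, haα⟩ := exists_between hp
  obtain ⟨C, -, hC⟩ := exists_absTail_le_rpow (one_lt_two_rpow_inv hα0) hμ (hp0.trans hpa).le
    (two_rpow_inv_rpow_lt hα0 haα)
  have hm : Measurable fun x : ℝ => |x| ^ p := by fun_prop
  exact (lintegral_ofReal_ne_top_iff_integrable hm.aestronglyMeasurable
    (ae_of_all _ fun x => Real.rpow_nonneg (abs_nonneg x) p)).1
    (lintegral_abs_rpow_lt_top_of_absTail_le hp0 hpa fun x hx => hC x (by linarith)).ne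

/-- Were `x ^ b * absTail μ x` bounded, the moment of order `α < b` would be finite, which
non-degeneracy forbids. The condition `b < 2 * α` lets the upper bound hold with exponent `b / 2`.
-/
lemma exists_rpow_le_absTail_of_conv (hα0 : 0 < α) (hα2 : α < 2)
    (hμ : μ.conv μ = μ.map (fun x => 2 ^ (1 / α) * x)) (hnd : ∀ y, ¬ ∀ᵐ x ∂μ, x = y) {b : ℝ}
    (hb : α < b) (hb2 : b < 2 * α) :
    ∃ K : ℝ, 0 < K ∧ ∃ x₀ : ℝ, 0 < x₀ ∧ ∀ x, x₀ ≤ x → K * x ^ (-b) ≤ absTail μ x := by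
  have e : 2 * (b / 2) = b := by ring
  have h := exists_rpow_le_absTail (a := b / 2) (one_lt_two_rpow_inv hα0) hμ (by linarith)
    (two_rpow_inv_rpow_lt hα0 (by linarith)) (by rw [e]; exact lt_two_rpow_inv_rpow hα0 hb)
  rw [e] at h
  refine h ?_
  by_contra! hcon
  obtain ⟨K, hK⟩ := hcon
  refine (lintegral_abs_rpow_lt_top_of_absTail_le (μ := μ) (C := K) hα0 hb fun x hx => ?_).ne
    (lintegral_abs_rpow_eq_top (by positivity) hα0 hα2
      (by rw [two_rpow_inv_rpow, div_self hα0.ne', Real.rpow_one]) hμ hnd)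
  have hx0 : 0 < x := by linarith
  rw [Real.rpow_neg hx0.le, ← div_eq_mul_inv, le_div_iff₀ (by positivity), mul_comm]
  exact (hK x hx0).le

end Stable

/-! ### Increments of the process and their empirical moments -/

section Increments

variable {Ω : Type*} [MeasurableSpace Ω] {P : Measure Ω} {X : ℝ≥0 → Ω → ℝ}

/-- The increment of `X` over the `n`-th window of length `τ`. -/
noncomputable def windowIncrement (X : ℝ≥0 → Ω → ℝ) (τ n : ℕ) (ω : Ω) : ℝ :=
  X (((n + 1) * τ : ℕ) : ℝ≥0) ω - X ((n * τ : ℕ) : ℝ≥0) ω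

omit [MeasurableSpace Ω] in
lemma windowIncrement_eq_sum (X : ℝ≥0 → Ω → ℝ) (τ n : ℕ) (ω : Ω) :
    windowIncrement X τ n ω = ∑ i ∈ Finset.range τ, windowIncrement X 1 (n * τ + i) ω := by
  have h := Finset.sum_range_sub (fun i : ℕ => X ((n * τ + i : ℕ) : ℝ≥0) ω) τ
  simp only [windowIncrement, mul_one, Nat.succ_mul, add_zero, add_assoc] at h ⊢
  exact h.symm

omit [MeasurableSpace Ω] in
lemma empiricalMoment_mul (X : ℝ≥0 → Ω → ℝ) (q : ℝ) {τ : ℕ} (hτ : 0 < τ) (m : ℕ) (ω : Ω) :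
    empiricalMoment X q τ (m * τ) ω =
      (∑ n ∈ Finset.range m, |windowIncrement X τ n ω| ^ q) / m := by
  rw [empiricalMoment, Nat.mul_div_cancel _ hτ, one_div, inv_mul_eq_div]
  rfl

lemma IsLevyProcess.measurable_windowIncrement (hX : IsLevyProcess X P) (τ n : ℕ) :
    Measurable (windowIncrement X τ n) :=
  (hX.measurable _).sub (hX.measurable _)

lemma IsLevyProcess.iIndepFun_windowIncrement (hX : IsLevyProcess X P) (τ : ℕ) :
    iIndepFun (windowIncrement X τ) P :=
  hX.indep.nat (t := fun n => ((n * τ : ℕ) : ℝ≥0)) fun _ _ h =>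
    Nat.cast_le.2 (Nat.mul_le_mul_right τ h)

lemma IsLevyProcess.identDistrib_windowIncrement (hX : IsLevyProcess X P) (τ n : ℕ) :
    IdentDistrib (windowIncrement X τ n) (X τ) P P := by
  have h1 := hX.stationary ((n * τ : ℕ) : ℝ≥0) (τ : ℝ≥0)
  have h2 : (((n + 1) * τ : ℕ) : ℝ≥0) = ((n * τ : ℕ) : ℝ≥0) + (τ : ℝ≥0) := by
    push_cast
    ring
  have h3 : IdentDistrib (fun ω => X τ ω - X 0 ω) (X τ) P P := by
    refine IdentDistrib.of_ae_eq ((hX.measurable _).sub (hX.measurable _)).aemeasurable ?_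
    filter_upwards [hX.start_zero] with ω hω
    rw [hω, sub_zero]
  have h4 : windowIncrement X τ n =
      fun ω => X (((n * τ : ℕ) : ℝ≥0) + (τ : ℝ≥0)) ω - X ((n * τ : ℕ) : ℝ≥0) ω := by
    ext ω
    rw [windowIncrement, h2]
  rw [h4]
  exact h1.trans h3

variable {α : ℝ}

lemma IsSelfSimilarLevyProcess.map_windowIncrement (hX : IsSelfSimilarLevyProcess α X P) {τ : ℕ}
    (hτ : 0 < τ) (n : ℕ) :
    P.map (windowIncrement X τ n) = (P.map (X 1)).map (fun x => (τ : ℝ) ^ (1 / α) * x) := by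
  rw [(hX.toIsLevyProcess.identDistrib_windowIncrement τ n).map_eq]
  have h := (hX.selfSimilar (τ : ℝ≥0) 1 (by exact_mod_cast hτ) one_pos).map_eq
  rw [mul_one] at h
  rw [h, Measure.map_map (by fun_prop) (hX.measurable 1)]
  rfl

lemma IsSelfSimilarLevyProcess.map_windowIncrement_one (hX : IsSelfSimilarLevyProcess α X P)
    (n : ℕ) : P.map (windowIncrement X 1 n) = P.map (X 1) := by
  rw [hX.map_windowIncrement one_pos]
  simp

variable [IsProbabilityMeasure P]

/-- `X 2` is, up to its null starting value, a sum of two independent unit increments, and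
self-similarity identifies its law. -/
lemma IsSelfSimilarLevyProcess.conv_map_one (hX : IsSelfSimilarLevyProcess α X P) :
    (P.map (X 1)).conv (P.map (X 1)) = (P.map (X 1)).map (fun x => 2 ^ (1 / α) * x) := by
  have hL := hX.toIsLevyProcess
  have h1 := (hL.iIndepFun_windowIncrement 1).indepFun (i := 0) (j := 1) zero_ne_one
  have h2 := h1.map_add_eq_map_conv_map (hL.measurable_windowIncrement 1 0)
    (hL.measurable_windowIncrement 1 1)
  rw [hX.map_windowIncrement_one, hX.map_windowIncrement_one] at h2
  have h3 : windowIncrement X 1 0 + windowIncrement X 1 1 = windowIncrement X 2 0 := by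
    ext ω
    rw [windowIncrement_eq_sum X 2 0]
    simp [Finset.sum_range_succ]
  rw [← h2, h3, hX.map_windowIncrement two_pos]
  simp

omit [IsProbabilityMeasure P] in
lemma IsSelfSimilarLevyProcess.not_ae_eq_const (hX : IsSelfSimilarLevyProcess α X P) (y : ℝ) :
    ¬ ∀ᵐ x ∂(P.map (X 1)), x = y := fun h =>
  hX.nondegenerate y (ae_of_ae_map (hX.measurable 1).aemeasurable h)

/-- Strong law for the empirical moments of order `q < α`. -/
lemma IsSelfSimilarLevyProcess.ae_tendsto_average (hX : IsSelfSimilarLevyProcess α X P)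
    (hα0 : 0 < α) {q : ℝ} (hq0 : 0 ≤ q) (hq : q < α) {τ : ℕ} (hτ : 0 < τ) :
    ∀ᵐ ω ∂P, Tendsto
      (fun m : ℕ => (∑ n ∈ Finset.range m, |windowIncrement X τ n ω| ^ q) / m) atTop
      (𝓝 ((τ : ℝ) ^ (q / α) * ∫ x, |x| ^ q ∂(P.map (X 1)))) := by
  have hL := hX.toIsLevyProcess
  have : IsProbabilityMeasure (P.map (X 1)) :=
    Measure.isProbabilityMeasure_map (hX.measurable 1).aemeasurable
  have hpow : Measurable fun x : ℝ => |x| ^ q := by fun_prop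
  have hm := hL.measurable_windowIncrement τ
  have hscale : ∀ x : ℝ, |(τ : ℝ) ^ (1 / α) * x| ^ q = (τ : ℝ) ^ (q / α) * |x| ^ q := by
    intro x
    rw [abs_mul, Real.mul_rpow (abs_nonneg _) (abs_nonneg _), abs_of_nonneg (by positivity),
      ← Real.rpow_mul (Nat.cast_nonneg _)]
    congr 2
    ring
  have hint : Integrable (fun x => |x| ^ q) (P.map (windowIncrement X τ 0)) := by
    rw [hX.map_windowIncrement hτ, integrable_map_measure hpow.aestronglyMeasurable (by fun_prop)]
    simp only [Function.comp_def, hscale]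
    exact (integrable_abs_rpow_of_conv hα0 hX.conv_map_one hq0 hq).const_mul _
  have hmean : ∫ ω, |windowIncrement X τ 0 ω| ^ q ∂P =
      (τ : ℝ) ^ (q / α) * ∫ x, |x| ^ q ∂(P.map (X 1)) := by
    rw [← integral_map (f := fun x : ℝ => |x| ^ q) (hm 0).aemeasurable hpow.aestronglyMeasurable,
      hX.map_windowIncrement hτ, integral_map (by fun_prop) hpow.aestronglyMeasurable]
    simp only [hscale, integral_const_mul]
  rw [← hmean]
  refine strong_law_ae_real (fun n ω => |windowIncrement X τ n ω| ^ q)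
    ((integrable_map_measure hpow.aestronglyMeasurable (hm 0).aemeasurable).1 hint)
    (fun i j hij => ((hL.iIndepFun_windowIncrement τ).indepFun hij).comp hpow hpow) fun n => ?_
  exact ((hL.identDistrib_windowIncrement τ n).trans
    (hL.identDistrib_windowIncrement τ 0).symm).comp hpow

lemma IsSelfSimilarLevyProcess.integral_abs_rpow_ne_zero (hX : IsSelfSimilarLevyProcess α X P)
    (hα0 : 0 < α) {q : ℝ} (hq0 : 0 ≤ q) (hq : q < α) : ∫ x, |x| ^ q ∂(P.map (X 1)) ≠ 0 := by
  have : IsProbabilityMeasure (P.map (X 1)) :=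
    Measure.isProbabilityMeasure_map (hX.measurable 1).aemeasurable
  intro h
  rw [integral_eq_zero_iff_of_nonneg (fun x => Real.rpow_nonneg (abs_nonneg x) q)
    (integrable_abs_rpow_of_conv hα0 hX.conv_map_one hq0 hq)] at h
  refine hX.not_ae_eq_const 0 ?_
  filter_upwards [h] with x hx
  exact abs_eq_zero.1 ((Real.rpow_eq_zero_iff_of_nonneg (abs_nonneg x)).1 hx).1

/-- In the heavy-tailed regime `α ≤ q` the sums of `q`-th powers of the unit increments outgrow
the sums of the products of distinct increments inside a window. -/
lemma IsSelfSimilarLevyProcess.exists_growth (hX : IsSelfSimilarLevyProcess α X P)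
    (hα0 : 0 < α) (hα2 : α < 2) {q : ℝ} (hq : α ≤ q) :
    ∃ r : ℝ, 0 < r ∧ r ≤ 1 ∧ q / 2 * r < α ∧ ∀ᵐ ω ∂P, Tendsto
      (fun N : ℕ => (∑ n ∈ Finset.range N, |windowIncrement X 1 n ω| ^ q) / (N : ℝ) ^ (1 / r))
      atTop atTop := by
  have hL := hX.toIsLevyProcess
  have hm := hL.measurable_windowIncrement 1
  have hind := hL.iIndepFun_windowIncrement 1
  have hlaw := hX.map_windowIncrement_one
  have : IsProbabilityMeasure (P.map (X 1)) :=
    Measure.isProbabilityMeasure_map (hX.measurable 1).aemeasurable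
  have hq0 : 0 < q := hα0.trans_le hq
  rcases hq.eq_or_lt with rfl | hlt
  -- At `q = α` no polynomial gain is available; the strong law with infinite mean beats the linear
  -- rate.
  · refine ⟨1, one_pos, le_rfl, by linarith, ?_⟩
    have hpow : Measurable fun x : ℝ => |x| ^ α := by fun_prop
    have htop := lintegral_abs_rpow_eq_top (r := α) (by positivity) hα0 hα2
      (by rw [two_rpow_inv_rpow, div_self hα0.ne', Real.rpow_one]) hX.conv_map_one
      hX.not_ae_eq_const
    rw [← hlaw 0, lintegral_map hpow.ennreal_ofReal (hm 0)] at htop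
    filter_upwards [ae_tendsto_average_atTop (fun n => hpow.comp (hm n))
      (fun n ω => Real.rpow_nonneg (abs_nonneg _) _)
      (fun i j hij => (hind.indepFun hij).comp hpow hpow)
      (fun n => ((hL.identDistrib_windowIncrement 1 n).trans
        (hL.identDistrib_windowIncrement 1 0).symm).comp hpow) htop] with ω hω
    simpa using hω
  -- Finite moments of the products need `r < 2 * α / q`, and fast growth needs `α / q < r`; `3 * α
  -- / (2 * q)` is the midpoint.
  · set r := min 1 (3 * α / (2 * q)) with hr
    have hr0 : 0 < r := lt_min one_pos (by positivity)
    have hrle : r ≤ 3 * α / (2 * q) := min_le_right _ _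
    have hrgt : α / q < r := by
      refine lt_min ((div_lt_one hq0).2 hlt) ?_
      rw [div_lt_div_iff₀ hq0 (by positivity)]
      nlinarith
    refine ⟨r, hr0, min_le_left _ _, ?_, ?_⟩
    · rw [le_div_iff₀ (by positivity)] at hrle
      linarith
    have h1 : 1 / r < q / α := by
      rw [div_lt_iff₀ hq0] at hrgt
      rw [div_lt_div_iff₀ hr0 hα0]
      linarith
    -- The sums of `q`-th powers exceed `N ^ s` for any `s < q / α`, so `s` is taken strictly above
    -- `1 / r`.
    obtain ⟨s, hs1, hs2⟩ := exists_between h1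
    have hs0 : 0 < s := lt_trans (by positivity) hs1
    have h2 : α < min (2 * α) (q / s) := by
      refine lt_min (by linarith) ?_
      rw [lt_div_iff₀ hα0] at hs2
      rw [lt_div_iff₀ hs0]
      linarith
    obtain ⟨b, hb1, hb2⟩ := exists_between h2
    obtain ⟨hb3, hb4⟩ := lt_min_iff.1 hb2
    obtain ⟨K, hK, x₀, -, htail⟩ := exists_rpow_le_absTail_of_conv hα0 hα2 hX.conv_map_one
      hX.not_ae_eq_const hb1 hb3
    have hsb : s * b < q := by
      rw [lt_div_iff₀ hs0] at hb4
      linarith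
    filter_upwards [ae_eventually_rpow_le_sum hm hind hlaw hK htail hs0 hq0 hsb] with ω hω
    have hpow : Tendsto (fun N : ℕ => (N : ℝ) ^ (s - 1 / r)) atTop atTop :=
      (tendsto_rpow_atTop (by linarith)).comp tendsto_natCast_atTop_atTop
    refine tendsto_atTop_mono' _ ?_ hpow
    filter_upwards [hω, eventually_gt_atTop 0] with N hN hN0
    have hNpos : (0 : ℝ) < N := by exact_mod_cast hN0
    rw [Real.rpow_sub hNpos]
    exact div_le_div_of_nonneg_right hN (by positivity)

lemma IsSelfSimilarLevyProcess.ae_tendsto_sum_div (hX : IsSelfSimilarLevyProcess α X P)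
    (hα0 : 0 < α) (hα2 : α < 2) {q : ℝ} (hq : α ≤ q) {τ : ℕ} (hτ : 0 < τ) :
    ∀ᵐ ω ∂P, Tendsto
      (fun m : ℕ => (∑ n ∈ Finset.range m, |windowIncrement X τ n ω| ^ q) /
        ∑ n ∈ Finset.range (m * τ), |windowIncrement X 1 n ω| ^ q) atTop (𝓝 1) := by
  have hL := hX.toIsLevyProcess
  have : IsProbabilityMeasure (P.map (X 1)) :=
    Measure.isProbabilityMeasure_map (hX.measurable 1).aemeasurable
  have hq0 : 0 < q := hα0.trans_le hq
  obtain ⟨r, hr0, hr1, hqr, hgrowth⟩ := hX.exists_growth hα0 hα2 hq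
  have hint := integrable_abs_rpow_of_conv (p := q / 2 * r) hα0 hX.conv_map_one (by positivity) hqr
  have hcross : ∀ᵐ ω ∂P, ∀ a b : ℕ, a < τ → b < τ → a ≠ b → ∃ C : ℝ, ∀ m : ℕ,
      ∑ j ∈ Finset.range m, (|windowIncrement X 1 (j * τ + a) ω| *
        |windowIncrement X 1 (j * τ + b) ω|) ^ (q / 2) ≤ C * (m : ℝ) ^ (1 / r) := by
    simp only [ae_all_iff]
    intro a b ha hb hab
    exact ae_exists_sum_cross_le (ξ := windowIncrement X 1) (hL.measurable_windowIncrement 1)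
      (hL.iIndepFun_windowIncrement 1) hX.map_windowIncrement_one hr0 hr1 hint ha hb hab
  filter_upwards [hgrowth, hcross] with ω h1 h2
  simp only [windowIncrement_eq_sum X τ]
  exact tendsto_sum_block_rpow_div (x := fun n => windowIncrement X 1 n ω) hτ hq0
    (by positivity) h1 h2

end Increments

/-! ### The limit along multiples of the least common multiple -/

lemma lcmUpTo_pos (T : ℕ) : 0 < lcmUpTo T := by
  refine Nat.pos_of_ne_zero fun h => ?_
  obtain ⟨i, hi, h0⟩ := Finset.lcm_eq_zero_iff.1 h
  rw [Finset.mem_Icc] at hi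
  simp only [id_eq] at h0
  omega

theorem theorem3 {Ω : Type*} [MeasurableSpace Ω] (P : Measure Ω) [IsProbabilityMeasure P]
    (X : ℝ≥0 → Ω → ℝ) (α : ℝ) (hα0 : 0 < α) (hα2 : α < 2)
    (hX : IsSelfSimilarLevyProcess α X P) (T : ℕ) (hT : 0 < T) (q : ℝ) (hq : 0 ≤ q) :
    ∀ᵐ ω ∂P, ∀ τ ∈ Finset.Icc 1 T,
      Tendsto
        (fun k : ℕ => empiricalMoment X q τ (k * lcmUpTo T) ω /
          empiricalMoment X q 1 (k * lcmUpTo T) ω)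
        atTop (𝓝 ((τ : ℝ) ^ empiricalScaling α q)) := by
  rw [eventually_all_finset]
  intro τ hτmem
  have hτ : 0 < τ := (Finset.mem_Icc.1 hτmem).1
  obtain ⟨l, hl⟩ : τ ∣ lcmUpTo T := Finset.dvd_lcm (f := id) hτmem
  have hl0 : 0 < l := by
    have := lcmUpTo_pos T
    rw [hl] at this
    exact Nat.pos_of_mul_pos_left this
  have hlim : Tendsto (fun k : ℕ => k * l) atTop atTop := tendsto_id.atTop_mul_const' hl0
  have hN : ∀ k : ℕ, k * lcmUpTo T = k * l * τ := fun k => by rw [hl]; ring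
  have hone : ∀ N ω, empiricalMoment X q 1 N ω =
      (∑ n ∈ Finset.range N, |windowIncrement X 1 n ω| ^ q) / N := fun N ω => by
    simpa using empiricalMoment_mul X q one_pos N ω
  simp only [hN, hone, empiricalMoment_mul X q hτ]
  unfold empiricalScaling
  split_ifs with hqα
  · filter_upwards [hX.ae_tendsto_average hα0 hq hqα hτ, hX.ae_tendsto_average hα0 hq hqα one_pos]
      with ω h1 h2
    have hE := hX.integral_abs_rpow_ne_zero hα0 hq hqα
    rw [Nat.cast_one, Real.one_rpow, one_mul] at h2
    have h3 := (h1.comp hlim).div (h2.comp (hlim.atTop_mul_const' hτ)) hE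
    rw [mul_div_cancel_right₀ _ hE] at h3
    exact h3
  · filter_upwards [hX.ae_tendsto_sum_div hα0 hα2 (not_lt.1 hqα) hτ] with ω h1
    have h2 := (h1.comp hlim).const_mul (τ : ℝ)
    rw [mul_one] at h2
    rw [Real.rpow_one]
    refine h2.congr' ?_
    -- For `k > 0`, `k * l` windows of length `τ` are averaged against `k * l * τ` unit windows,
    -- which leaves the factor `τ`.
    filter_upwards [hlim.eventually_gt_atTop 0] with k hk
    have hk0 : ((k * l : ℕ) : ℝ) ≠ 0 := by exact_mod_cast hk.ne'
    simp only [Function.comp_apply]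
    rw [Nat.cast_mul (k * l) τ, div_div_div_eq, mul_left_comm _ ((k * l : ℕ) : ℝ) (τ : ℝ),
      mul_div_mul_left _ _ hk0]
    ring
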